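/- Let $\mathcal X,\mathcal Y$ be finite nonempty action sets, $m_x=|\mathcal X|$, and let $u:\mathcal X\times\mathcal Y\to[-1,1]$ be the utility of a zero-sum game (the learner maximizes). In rounds $t=1,2,\dots$ the learner samples $x^t\in\mathcal X$ from a distribution $p^t$ while an adaptive adversary simultaneously picks $y^t\in\mathcal Y$, possibly at random and depending on the whole history; then the learner observes only a reward $r_t\in[-1,1]$ whose conditional mean, given the history and $x^t,y^t$, is $u(x^t,y^t)$. The learner runs Tsallis-INF with $\alpha=\frac12$ and $\eta_t=\frac1{2\sqrt t}$: $$p^t=\operatorname*{argmax}_{p\in\Delta(\mathcal X)}\Big\{\Big\langle p,\sum_{s<t}g^s\Big\rangle+\frac1{\eta_t}\varphi_\alpha(p)\Big\},\quad \varphi_\alpha(p)=\frac1\alpha\sum_{x}(p_x^\alpha-p_x),$$ where $g^t_x=1-(1-r_t)/p^t_x$ if $x=x^t$ and $g^t_x=1$ otherwise. Let $v^\star=\max_x\min_y u(x,y)$ and let $\mathrm{PSMR}_T=\mathbb E\big[\sum_{t=1}^T(v^\star-u(x^t,y^t))\big]$ be the pure-strategy maximin regret. There is a universal constant $C>0$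 such that, for every such game, adversary and noise: 1. $\mathrm{PSMR}_T\le C\sqrt{m_xT}$ for all $T$. 2. If $(x^*,y^*)$ is a strict pure-strategy Nash equilibrium (PSNE), that is, $u(x,y^*)<u(x^*,y^*)$ for all $x\ne x^*$ and $u(x^*,y^*)<u(x^*,y)$ for all $y\neq y^*$, then for all $T\ge2$ $$\mathrm{PSMR}_T\le \frac{C}{\Delta^C_{\min}}\sum_{x\ne x^*}\frac{\log T}{\Delta^R_x},\quad \Delta^R_x=u(x^*,y^*)-u(x,y^*),\quad \Delta^C_{\min}=\min_{y\ne y^*}\big(u(x^*,y)-u(x^*,y^*)\big),$$ where the factor $1/\Delta^C_{\min}$ is read as $1$ if $|\mathcal Y|=1$. 3. If the game has no PSNE, i.e. there is no $(x^*,y^*)$ with $u(x,y^*)\le u(x^*,y^*)\le u(x^*,y)$ for all $x,y$, and $\Delta^{\mathrm{Mix}}=v^{\mathrm{Mix}}-v^\star>0$, where $v^{\mathrm{Mix}}$ is the value of the mixed-strategy Nash equilibria, then $\mathrm{PSMR}_T\le C\,m_x/\Delta^{\mathrm{Mix}}$ for all $T$. -/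

import Mathlib

open MeasureTheory ProbabilityTheory

noncomputable section

namespace ZeroSumGame

/-! ### Finite zero-sum games

The learner's actions form a finite type `X`, the adversary's a finite type `Y`; `u x y` is the
learner's expected reward when she plays `x` and the adversary plays `y`. -/

section Game

variable {X Y : Type*}

/-- `(xs, ys)` is a pure-strategy Nash equilibrium. -/
def IsPSNE (u : X → Y → ℝ) (xs : X) (ys : Y) : Prop :=
  (∀ x, u x ys ≤ u xs ys) ∧ ∀ y, u xs ys ≤ u xs y

/-- `(xs, ys)` is a strict pure-strategy Nash equilibrium. -/
def IsStrictPSNE (u : X → Y → ℝ) (xs : X) (ys : Y) : Prop :=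
  (∀ x, x ≠ xs → u x ys < u xs ys) ∧ ∀ y, y ≠ ys → u xs ys < u xs y

/-- The learner's gap of the action `x` with respect to the equilibrium `(xs, ys)`. -/
def rowGap (u : X → Y → ℝ) (xs : X) (ys : Y) (x : X) : ℝ := u xs ys - u x ys

/-- The adversary's gap of the action `y` with respect to the equilibrium `(xs, ys)`. -/
def colGap (u : X → Y → ℝ) (xs : X) (ys : Y) (y : Y) : ℝ := u xs y - u xs ys

/-- The smallest gap of an adversary's action different from `ys` (meaningful when the adversary
has at least two actions). -/
def minColGap (u : X → Y → ℝ) (xs : X) (ys : Y) : ℝ := ⨅ y : {y : Y // y ≠ ys}, colGap u xs ys y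

/-- The pure-strategy maximin value `max_x min_y u x y`. -/
def vStar (u : X → Y → ℝ) : ℝ := ⨆ x, ⨅ y, u x y

variable [Fintype X] [Fintype Y]

/-- The expected reward `u(p, q)` under independent mixed strategies `p` and `q`. -/
def mixedUtility (u : X → Y → ℝ) (p : X → ℝ) (q : Y → ℝ) : ℝ := ∑ x, ∑ y, p x * q y * u x y

/-- `(ps, qs)` is a mixed-strategy Nash equilibrium. -/
def IsMSNE (u : X → Y → ℝ) (ps : X → ℝ) (qs : Y → ℝ) : Prop :=
  ps ∈ stdSimplex ℝ X ∧ qs ∈ stdSimplex ℝ Y ∧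
    (∀ p ∈ stdSimplex ℝ X, mixedUtility u p qs ≤ mixedUtility u ps qs) ∧
    ∀ q ∈ stdSimplex ℝ Y, mixedUtility u ps qs ≤ mixedUtility u ps q

/-- The Nash value `max_p min_q u(p, q)`. By `exists_isMSNE` and `IsMSNE.mixedUtility_eq` below,
it is the common value `u(ps, qs)` of all mixed-strategy Nash equilibria, of which there is at
least one. -/
def vMix (u : X → Y → ℝ) : ℝ :=
  ⨆ p : stdSimplex ℝ X, ⨅ q : stdSimplex ℝ Y, mixedUtility u p q

/-- The gap between the Nash value and the pure-strategy maximin value. -/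
def mixGap (u : X → Y → ℝ) : ℝ := vMix u - vStar u

theorem continuous_mixedUtility (u : X → Y → ℝ) :
    Continuous fun z : (X → ℝ) × (Y → ℝ) => mixedUtility u z.1 z.2 := by
  unfold mixedUtility
  fun_prop

theorem exists_isMSNE [Nonempty X] [Nonempty Y] (u : X → Y → ℝ) :
    ∃ ps qs, IsMSNE u ps qs := by
  classical
  have hneX : (stdSimplex ℝ X).Nonempty :=
    ⟨_, single_mem_stdSimplex ℝ (Classical.arbitrary X)⟩
  have hneY : (stdSimplex ℝ Y).Nonempty :=
    ⟨_, single_mem_stdSimplex ℝ (Classical.arbitrary Y)⟩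
  have hlinP : ∀ (q : Y → ℝ) (p p' : X → ℝ) (a b : ℝ), mixedUtility u (a • p + b • p') q
      = a * mixedUtility u p q + b * mixedUtility u p' q := by
    intro q p p' a b
    simp only [mixedUtility, Finset.mul_sum, ← Finset.sum_add_distrib]
    refine Finset.sum_congr rfl fun x _ => Finset.sum_congr rfl fun y _ => ?_
    simp only [Pi.add_apply, Pi.smul_apply, smul_eq_mul]
    ring
  have hlinQ : ∀ (p : X → ℝ) (q q' : Y → ℝ) (a b : ℝ), mixedUtility u p (a • q + b • q')
      = a * mixedUtility u p q + b * mixedUtility u p q' := by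
    intro p q q' a b
    simp only [mixedUtility, Finset.mul_sum, ← Finset.sum_add_distrib]
    refine Finset.sum_congr rfl fun x _ => Finset.sum_congr rfl fun y _ => ?_
    simp only [Pi.add_apply, Pi.smul_apply, smul_eq_mul]
    ring
  obtain ⟨qs, hq, ps, hp, h⟩ := Sion.exists_isSaddlePointOn
    (X := stdSimplex ℝ Y) (Y := stdSimplex ℝ X) (f := fun q p => mixedUtility u p q)
    hneY (convex_stdSimplex ℝ Y) (isCompact_stdSimplex ℝ Y)
    (fun p _ => ((continuous_mixedUtility u).comp
      (continuous_const.prodMk continuous_id)).continuousOn.lowerSemicontinuousOn)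
    (fun p _ => ConvexOn.quasiconvexOn ⟨convex_stdSimplex ℝ Y, fun q _ q' _ a b _ _ _ =>
      (hlinQ p q q' a b).le⟩)
    (convex_stdSimplex ℝ X) hneX (isCompact_stdSimplex ℝ X)
    (fun q _ => ((continuous_mixedUtility u).comp
      (continuous_id.prodMk continuous_const)).continuousOn.upperSemicontinuousOn)
    (fun q _ => ConcaveOn.quasiconcaveOn ⟨convex_stdSimplex ℝ X, fun p _ p' _ a b _ _ _ =>
      (hlinP q p p' a b).ge⟩)
  exact ⟨ps, qs, hp, hq, fun p hp' => h qs hq p hp', fun q hq' => h q hq' ps hp⟩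

theorem IsMSNE.mixedUtility_eq {u : X → Y → ℝ} {ps : X → ℝ} {qs : Y → ℝ}
    (h : IsMSNE u ps qs) : mixedUtility u ps qs = vMix u := by
  obtain ⟨hp, hq, h1, h2⟩ := h
  have : Nonempty (stdSimplex ℝ X) := ⟨⟨ps, hp⟩⟩
  have : Nonempty (stdSimplex ℝ Y) := ⟨⟨qs, hq⟩⟩
  have hb : ∀ p : stdSimplex ℝ X,
      BddBelow (Set.range fun q : stdSimplex ℝ Y => mixedUtility u p q) := fun p =>
    (isCompact_range ((continuous_mixedUtility u).comp
      (continuous_const.prodMk continuous_subtype_val))).bddBelow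
  have hle : ∀ p : stdSimplex ℝ X,
      (⨅ q : stdSimplex ℝ Y, mixedUtility u p q) ≤ mixedUtility u ps qs := fun p =>
    (ciInf_le (hb p) ⟨qs, hq⟩).trans (h1 p p.2)
  refine le_antisymm ?_ (ciSup_le hle)
  exact (le_ciInf fun q : stdSimplex ℝ Y => h2 q q.2).trans
    (le_ciSup (f := fun p : stdSimplex ℝ X => ⨅ q : stdSimplex ℝ Y, mixedUtility u p q)
      ⟨_, Set.forall_mem_range.2 hle⟩ ⟨ps, hp⟩)

end Game

/-! ### The Tsallis-INF algorithm -/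

section Algorithm

variable {X : Type*} [Fintype X]

/-- The Tsallis entropy `φ_α(p) = (1/α) ∑ (p_i ^ α - p_i)`. -/
def tsallisEntropy (α : ℝ) (p : X → ℝ) : ℝ := 1 / α * ∑ i, (p i ^ α - p i)

open Classical in
/-- The importance-weighted reward estimator, when `x` was sampled from `p` and the reward `r` was
observed. -/
def rewardEstimator (p : X → ℝ) (x : X) (r : ℝ) (a : X) : ℝ :=
  if x = a then 1 - (1 - r) / p a else 1

/-- Along the trajectory of actions `x` and observed rewards `r`, the mixed strategies `p` are
those of Tsallis-INF with parameter `α` and learning rates `η`: each is a maximiser over the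
simplex of the regularised cumulative estimated reward. The index `t` stands for round `t + 1`,
whose learning rate is `η (t + 1)`. -/
def IsTsallisINF (α : ℝ) (η : ℕ → ℝ) (x : ℕ → X) (r : ℕ → ℝ) (p : ℕ → X → ℝ) : Prop :=
  ∀ t, p t ∈ stdSimplex ℝ X ∧
    IsMaxOn (fun w : X → ℝ =>
        ∑ a, w a * ∑ s ∈ Finset.range t, rewardEstimator (p s) (x s) (r s) a
          + 1 / η (t + 1) * tsallisEntropy α w)
      (stdSimplex ℝ X) (p t)

end Algorithm

/-! ### Repeated play against an adaptive adversary -/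

section Play

variable {X Y Ω : Type*} [MeasurableSpace Ω]

/-- Repeated play of the game `u`. The index `t` stands for round `t + 1`; `x t`, `y t`, `r t` are
the learner's action, the adversary's action and the reward of that round, `p t` is the mixed
strategy from which the learner samples, and `ℱ t` is the history before that round (it contains
the actions and rewards of all earlier rounds, and possibly private randomness of the
adversary). -/
structure IsPlay (P : Measure Ω) (u : X → Y → ℝ) (ℱ : Filtration ℕ ‹MeasurableSpace Ω›)
    (x : ℕ → Ω → X) (y : ℕ → Ω → Y) (r : ℕ → Ω → ℝ) (p : ℕ → Ω → X → ℝ) : Prop where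
  measurable_x : ∀ t, Measurable[ℱ (t + 1), ⊤] (x t)
  measurable_y : ∀ t, Measurable[ℱ (t + 1), ⊤] (y t)
  measurable_r : ∀ t, Measurable[ℱ (t + 1)] (r t)
  reward_mem : ∀ t ω, r t ω ∈ Set.Icc (-1 : ℝ) 1
  /-- Given the history and the adversary's (simultaneous, arbitrary, history-dependent) choice,
  the learner's action has law `p t`. -/
  sample : ∀ t a,
    P⟦x t ⁻¹' {a} | ℱ t ⊔ MeasurableSpace.comap (y t) ⊤⟧ =ᵐ[P] fun ω => p t ω a
  /-- Given the history and both actions, the noise has mean zero. -/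
  mean_reward : ∀ t,
    P[r t | ℱ t ⊔ MeasurableSpace.comap (x t) ⊤ ⊔ MeasurableSpace.comap (y t) ⊤]
      =ᵐ[P] fun ω => u (x t ω) (y t ω)

/-- The pure-strategy maximin regret after `T` rounds. -/
def psmr (P : Measure Ω) (u : X → Y → ℝ) (x : ℕ → Ω → X) (y : ℕ → Ω → Y) (T : ℕ) : ℝ :=
  ∫ ω, ∑ t ∈ Finset.range T, (vStar u - u (x t ω) (y t ω)) ∂P

end Play

end ZeroSumGame

end

open ZeroSumGame

-- Every bound comes from one estimate of external regret against a fixed action `i`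
-- (`IsPlay.regret_le`): it is at most the sum over rounds of 12/√t times the expected sum of √p_a
-- over a ≠ i, plus 6. What matters is that `i` itself is missing from the inner sum, so the bound
-- shrinks as play concentrates on `i`.
--
-- Pathwise this is follow-the-regularised-leader with regulariser -4√t ∑ √w_a, applied to
-- importance-weighted losses. The penalty loses the coordinate `i` because a vertex comparator has
-- entropy one (`ftrl_regret_single_le`). The stability loses it because a constant may be added to
-- the loss vector before it is estimated (`stability_shifted`). Taking expectations uses that the
-- loss estimator is unbiased given the history and the adversary's action
-- (`IsPlay.integral_lossEstimator`), so adaptivity is harmless against a fixed comparator.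
--
-- The three claims then follow. Worst case: compare with a pure maximin action and bound ∑ √p_a by
-- √m_x. Strict equilibrium: the maximin regret equals the external regret against x* minus what the
-- adversary gives away by leaving y*. Hence it is at most (1 + κ) times the external regret minus κ
-- times the accumulated row gaps, with κ of order Δ^C_min. Completing the square between √p_a and
-- p_a Δ^R_a leaves 1/(κ Δ^R_a t) per round, which sums to a logarithm (`IsPlay.psmr_le_log`). Mixed
-- gap: average the external regret over an equilibrium strategy. This secures v^Mix in every round,
-- so the maximin regret is O(√(m_x T)) - T Δ^Mix, which is bounded uniformly in T.

namespace ZeroSumGame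

/-! ### Follow-the-regularised-leader with the square-root regulariser, on a fixed trajectory. -/

section Ftrl

variable {X : Type*} [Fintype X]

/-- The linear loss `L` regularised by `β` times the Tsallis entropy with exponent `1 / 2`,
normalised up to a constant on the simplex. -/
noncomputable def sqrtObjective (β : ℝ) (L w : X → ℝ) : ℝ := ∑ a, w a * L a - 4 * β * ∑ a, √(w a)

/-- The square root has infinite slope at 0: moving mass ρ² onto an empty coordinate changes the
linear part by O(ρ²) but gains order ρ in the regulariser. -/
theorem pos_of_isMinOn_sqrtObjective {β : ℝ} {L w : X → ℝ} (hβ : 0 < β)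
    (hw : w ∈ stdSimplex ℝ X) (hmin : IsMinOn (sqrtObjective β L) (stdSimplex ℝ X) w) (i : X) :
    0 < w i := by
  classical
  rcases (hw.1 i).lt_or_eq with h | h
  · exact h
  exfalso
  set A := ∑ a, w a * L a with hA
  set B := ∑ a, √(w a) with hB
  have key : ∀ ρ : ℝ, 0 < ρ → ρ < 1 → 4 * β ≤ ρ * (L i - A + 4 * β * B) := by
    intro ρ h0 h1
    have hs1 : 0 ≤ 1 - ρ ^ 2 := by nlinarith
    have hmem : (1 - ρ ^ 2) • w + ρ ^ 2 • Pi.single i (1 : ℝ) ∈ stdSimplex ℝ X :=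
      convex_stdSimplex ℝ X hw (single_mem_stdSimplex ℝ i) hs1 (sq_nonneg ρ) (by ring)
    have hle := hmin hmem
    simp only [Set.mem_ofPred_eq, sqrtObjective] at hle
    have e1 : ∑ a, ((1 - ρ ^ 2) • w + ρ ^ 2 • Pi.single i (1 : ℝ) : X → ℝ) a * L a
        = (1 - ρ ^ 2) * A + ρ ^ 2 * L i := by
      simp [add_mul, Finset.sum_add_distrib, hA, Finset.mul_sum, mul_assoc, Pi.single_apply]
    have e2 : (1 - ρ ^ 2) * B + ρ
        ≤ ∑ a, √(((1 - ρ ^ 2) • w + ρ ^ 2 • Pi.single i (1 : ℝ) : X → ℝ) a) := by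
      have : (1 - ρ ^ 2) * B + ρ = ∑ a, ((1 - ρ ^ 2) * √(w a) + if a = i then ρ else 0) := by
        simp [Finset.sum_add_distrib, hB, Finset.mul_sum]
      rw [this]
      refine Finset.sum_le_sum fun a _ => ?_
      by_cases ha : a = i
      · subst ha
        simp [← h, Real.sqrt_sq h0.le]
      · simp only [ha, if_false, Pi.add_apply, Pi.smul_apply, smul_eq_mul, Pi.single_apply,
          mul_zero, add_zero]
        apply Real.le_sqrt_of_sq_le
        rw [mul_pow, Real.sq_sqrt (hw.1 a)]
        have := hw.1 a
        have : 0 ≤ (1 - ρ ^ 2) * w a * ρ ^ 2 := by positivity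
        nlinarith
    rw [e1, ← hA, ← hB] at hle
    have h2 := mul_le_mul_of_nonneg_left e2 (by positivity : 0 ≤ 4 * β)
    have h3 : ρ * (4 * β) ≤ ρ * (ρ * (L i - A + 4 * β * B)) := by nlinarith
    exact le_of_mul_le_mul_left h3 h0
  set K := L i - A + 4 * β * B with hK
  have hKpos : 0 < K := by
    have := key (1 / 2) (by norm_num) (by norm_num)
    linarith
  -- This ρ lies in (0, 1) and gives ρK ≤ β, which contradicts 4β ≤ ρK.
  have h1 := key (β / (β + K)) (by positivity) (by rw [div_lt_one (by positivity)]; linarith)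
  have h2 : β / (β + K) * K ≤ β := by
    rw [div_mul_eq_mul_div, div_le_iff₀ (by positivity)]
    nlinarith
  linarith

/-- The left side is the Bregman divergence of -4β ∑ √w. The objective is this regulariser plus a
linear term, so its increment is the divergence plus the directional derivative at the minimiser,
which is nonnegative. Positivity of the minimiser provides differentiability. -/
theorem sqrtObjective_growth {β : ℝ} {L w w' : X → ℝ} (hβ : 0 < β)
    (hw : w ∈ stdSimplex ℝ X) (hmin : IsMinOn (sqrtObjective β L) (stdSimplex ℝ X) w)
    (hw' : w' ∈ stdSimplex ℝ X) :
    2 * β * ∑ a, (√(w' a) - √(w a)) ^ 2 / √(w a)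
      ≤ sqrtObjective β L w' - sqrtObjective β L w := by
  have hpos := pos_of_isMinOn_sqrtObjective hβ hw hmin
  have hderiv : HasDerivAt (fun s : ℝ => sqrtObjective β L (fun a => w a + s * (w' a - w a)))
      (∑ a, (w' a - w a) * L a - 4 * β * ∑ a, (w' a - w a) / (2 * √(w a))) 0 := by
    unfold sqrtObjective
    have hl : ∀ a, HasDerivAt (fun s : ℝ => w a + s * (w' a - w a)) (w' a - w a) 0 := fun a => by
      simpa using ((hasDerivAt_id (0 : ℝ)).mul_const (w' a - w a)).const_add (w a)
    refine HasDerivAt.sub (HasDerivAt.fun_sum fun a _ => (hl a).mul_const _)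
      (HasDerivAt.const_mul _ (HasDerivAt.fun_sum fun a _ => ?_))
    have := (hl a).sqrt (by simpa using (hpos a).ne')
    simpa using this
  have hnn : 0 ≤ ∑ a, (w' a - w a) * L a - 4 * β * ∑ a, (w' a - w a) / (2 * √(w a)) := by
    refine ge_of_tendsto hderiv.tendsto_slope_zero_right ?_
    filter_upwards [Ioo_mem_nhdsGT (zero_lt_one (α := ℝ))] with s hs
    have hmem : (1 - s) • w + s • w' ∈ stdSimplex ℝ X :=
      convex_stdSimplex ℝ X hw hw' (by linarith [hs.2]) hs.1.le (by ring)
    have hle := hmin hmem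
    have e : (1 - s) • w + s • w' = fun a => w a + (0 + s) * (w' a - w a) := by
      ext a; simp; ring
    rw [Set.mem_ofPred_eq, e] at hle
    have hs0 := hs.1
    simp only [zero_mul, add_zero, smul_eq_mul]
    exact mul_nonneg (by positivity) (sub_nonneg.2 hle)
  have hid : sqrtObjective β L w' - sqrtObjective β L w
      - 2 * β * ∑ a, (√(w' a) - √(w a)) ^ 2 / √(w a)
      = ∑ a, (w' a - w a) * L a - 4 * β * ∑ a, (w' a - w a) / (2 * √(w a)) := by
    simp only [sqrtObjective, Finset.mul_sum, ← Finset.sum_sub_distrib]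
    refine Finset.sum_congr rfl fun a _ => ?_
    have h1 := Real.sqrt_pos.2 (hpos a)
    have h2 := Real.sq_sqrt (hw.1 a)
    have h3 := Real.sq_sqrt (hw'.1 a)
    generalize √(w a) = c at *
    generalize √(w' a) = d at *
    rw [← h2, ← h3]
    field_simp
    ring
  linarith

/-- One coordinate of the stability estimate, for a nonnegative loss. -/
theorem stability_coord_of_nonneg {a b l β : ℝ} (ha : 0 < a) (hl : 0 ≤ l) (hβ : 0 < β) :
    (a ^ 2 - b ^ 2) * l - 2 * β * ((b - a) ^ 2 / a) ≤ a ^ 3 * l ^ 2 / (2 * β) := by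
  -- Here `a` and `b` stand for the square roots of the two weights. Writing a² - b² = -2a(b - a) -
  -- (b - a)², the first part is completed to a square and the second has a good sign.
  have h : a ^ 3 * l ^ 2 / (2 * β) - ((a ^ 2 - b ^ 2) * l - 2 * β * ((b - a) ^ 2 / a))
      = (a ^ 2 * l + 2 * β * (b - a)) ^ 2 / (2 * β * a) + (b - a) ^ 2 * l := by
    field_simp
    ring
  have : 0 ≤ (a ^ 2 * l + 2 * β * (b - a)) ^ 2 / (2 * β * a) + (b - a) ^ 2 * l := by positivity
  linarith

/-- One coordinate of the stability estimate, for a bounded negative loss `-l`. -/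
theorem stability_coord_of_neg {a b l β : ℝ} (ha : 0 < a) (ha1 : a ≤ 1) (hl : 0 ≤ l)
    (hlβ : l ≤ β) (hβ : 0 < β) :
    (b ^ 2 - a ^ 2) * l - 2 * β * ((b - a) ^ 2 / a) ≤ a ^ 3 * l ^ 2 / β := by
  -- The term (b - a)² l now has the wrong sign. Half of the divergence absorbs it, since l a ≤ β;
  -- the other half completes the square, which costs a factor 2.
  have h : a ^ 3 * l ^ 2 / β - ((b ^ 2 - a ^ 2) * l - 2 * β * ((b - a) ^ 2 / a))
      = (a ^ 2 * l - β * (b - a)) ^ 2 / (β * a) + (b - a) ^ 2 * (β - l * a) / a := by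
    field_simp
    ring
  have h0 : 0 ≤ β - l * a := by nlinarith
  have : 0 ≤ (a ^ 2 * l - β * (b - a)) ^ 2 / (β * a) + (b - a) ^ 2 * (β - l * a) / a := by
    positivity
  linarith

theorem stability {β l : ℝ} {L w w' : X → ℝ} (hβ : 0 < β)
    (hw : w ∈ stdSimplex ℝ X) (hmin : IsMinOn (sqrtObjective β L) (stdSimplex ℝ X) w)
    (hw' : w' ∈ stdSimplex ℝ X) (hl : l ∈ Set.Icc (0 : ℝ) 2) (i : X) :
    (w i - w' i) * (l / w i)
      ≤ 2 / (β * √(w i)) + sqrtObjective β L w' - sqrtObjective β L w := by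
  have hpos := pos_of_isMinOn_sqrtObjective hβ hw hmin
  have hg := sqrtObjective_growth hβ hw hmin hw'
  have hs : (√(w' i) - √(w i)) ^ 2 / √(w i) ≤ ∑ a, (√(w' a) - √(w a)) ^ 2 / √(w a) :=
    Finset.single_le_sum (f := fun a => (√(w' a) - √(w a)) ^ 2 / √(w a))
      (fun a _ => by positivity) (Finset.mem_univ i)
  have hs' := mul_le_mul_of_nonneg_left hs (by positivity : 0 ≤ 2 * β)
  have hc := stability_coord_of_nonneg (b := √(w' i)) (Real.sqrt_pos.2 (hpos i))
    (div_nonneg hl.1 (hpos i).le) hβ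
  rw [Real.sq_sqrt (hw.1 i), Real.sq_sqrt (hw'.1 i)] at hc
  have hb : √(w i) ^ 3 * (l / w i) ^ 2 / (2 * β) ≤ 2 / (β * √(w i)) := by
    have h1 := Real.sqrt_pos.2 (hpos i)
    have h2 := Real.sq_sqrt (hw.1 i)
    generalize √(w i) = c at *
    rw [← h2]
    have : c ^ 3 * (l / c ^ 2) ^ 2 / (2 * β) = l ^ 2 / (2 * (β * c)) := by
      field_simp
    rw [this, div_le_div_iff₀ (by positivity) (by positivity)]
    have : l ^ 2 ≤ 4 := by nlinarith [hl.1, hl.2]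
    nlinarith [mul_pos hβ h1]
  linarith

/-- Both points have total mass one, so subtracting `l` from every coordinate of the loss changes
nothing. The loss becomes l(1 - w_i)/w_i at `i` and -l elsewhere. The resulting bound vanishes as
w_i tends to 1, and 2 ≤ β is what the negative losses require. -/
theorem stability_shifted [DecidableEq X] {β l : ℝ} {L w w' : X → ℝ} (hβ : 2 ≤ β)
    (hw : w ∈ stdSimplex ℝ X) (hmin : IsMinOn (sqrtObjective β L) (stdSimplex ℝ X) w)
    (hw' : w' ∈ stdSimplex ℝ X) (hl : l ∈ Set.Icc (0 : ℝ) 2) (i : X) :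
    (w i - w' i) * (l / w i)
      ≤ (2 * (1 - w i) ^ 2 / √(w i) + 4 * ∑ j ∈ Finset.univ.erase i, √(w j) ^ 3) / β
        + sqrtObjective β L w' - sqrtObjective β L w := by
  have hβ0 : 0 < β := by linarith
  have hpos := pos_of_isMinOn_sqrtObjective hβ0 hw hmin
  have hle1 : ∀ a, w a ≤ 1 := fun a => by
    rw [← hw.2]; exact Finset.single_le_sum (fun b _ => hw.1 b) (Finset.mem_univ a)
  have hg := sqrtObjective_growth hβ0 hw hmin hw'
  rw [← Finset.add_sum_erase _ _ (Finset.mem_univ i)] at hg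
  have h1 := hw.2
  have h2 := hw'.2
  rw [← Finset.add_sum_erase _ _ (Finset.mem_univ i)] at h1 h2
  have hc := stability_coord_of_nonneg (b := √(w' i)) (Real.sqrt_pos.2 (hpos i))
    (l := l * (1 - w i) / w i)
    (div_nonneg (mul_nonneg hl.1 (by linarith [hle1 i])) (hpos i).le) hβ0
  rw [Real.sq_sqrt (hw.1 i), Real.sq_sqrt (hw'.1 i)] at hc
  have ho : ∑ j ∈ Finset.univ.erase i, ((w' j - w j) * l
      - 2 * β * ((√(w' j) - √(w j)) ^ 2 / √(w j)))
      ≤ ∑ j ∈ Finset.univ.erase i, 4 * √(w j) ^ 3 / β := by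
    refine Finset.sum_le_sum fun j _ => ?_
    have hc := stability_coord_of_neg (b := √(w' j)) (Real.sqrt_pos.2 (hpos j))
      (Real.sqrt_le_one.2 (hle1 j)) hl.1 (hl.2.trans hβ) hβ0
    rw [Real.sq_sqrt (hw.1 j), Real.sq_sqrt (hw'.1 j)] at hc
    refine hc.trans ?_
    have : l ^ 2 ≤ 4 := by nlinarith [hl.1, hl.2]
    have h3 : 0 ≤ √(w j) ^ 3 := by positivity
    exact div_le_div_of_nonneg_right (by nlinarith) hβ0.le
  rw [Finset.sum_sub_distrib, ← Finset.sum_mul, ← Finset.mul_sum, Finset.sum_sub_distrib,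
    ← Finset.sum_div, ← Finset.mul_sum] at ho
  have hb : √(w i) ^ 3 * (l * (1 - w i) / w i) ^ 2 / (2 * β)
      ≤ 2 * (1 - w i) ^ 2 / √(w i) / β := by
    have h1 := Real.sqrt_pos.2 (hpos i)
    have h2 := Real.sq_sqrt (hw.1 i)
    generalize √(w i) = c at *
    rw [← h2]
    have : c ^ 3 * (l * (1 - c ^ 2) / c ^ 2) ^ 2 / (2 * β)
        = l ^ 2 / 4 * (2 * (1 - c ^ 2) ^ 2 / c / β) := by
      field_simp
      ring
    rw [this]
    refine mul_le_of_le_one_left (by positivity) ?_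
    nlinarith [hl.1, hl.2]
  have hsum : (∑ j ∈ Finset.univ.erase i, w' j - ∑ j ∈ Finset.univ.erase i, w j) = w i - w' i := by
    linarith
  rw [hsum] at ho
  have hsplit : (w i - w' i) * (l / w i)
      = (w i - w' i) * (l * (1 - w i) / w i) + (w i - w' i) * l := by
    have := (hpos i).ne'
    field_simp
    ring
  rw [hsplit, add_div]
  linarith

/-- The regret of follow-the-regularised-leader with stability terms `D` and learning rates
`1 / √(t + 1)`. -/
theorem ftrl_regret_le {w l : ℕ → X → ℝ} {D : ℕ → ℝ}
    (hstab : ∀ t, ∀ w' ∈ stdSimplex ℝ X, ∑ a, (w t a - w' a) * l t a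
      ≤ D t + sqrtObjective (√((t : ℝ) + 1)) (fun a => ∑ s ∈ Finset.range t, l s a) w'
        - sqrtObjective (√((t : ℝ) + 1)) (fun a => ∑ s ∈ Finset.range t, l s a) (w t))
    (hw : ∀ t, w t ∈ stdSimplex ℝ X) (n : ℕ) :
    ∀ w' ∈ stdSimplex ℝ X, ∑ t ∈ Finset.range n, ∑ a, w t a * l t a
      ≤ ∑ t ∈ Finset.range n, (D t + 4 * (√((t : ℝ) + 1) - √t) * ∑ a, √(w t a))
        + sqrtObjective (√(n : ℝ)) (fun a => ∑ s ∈ Finset.range n, l s a) w' := by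
  induction n with
  | zero => intro w' _; simp [sqrtObjective]
  | succ n ih =>
    intro w' hw'
    -- The first n rounds are compared with the next iterate, so that the objective at `w n` cancels
    -- against the stability bound up to the change of the regulariser from √n to √(n + 1).
    have h1 := ih (w n) (hw n)
    have h2 := hstab n w' hw'
    simp only [sqrtObjective, sub_mul, Finset.sum_sub_distrib] at h1 h2 ⊢
    simp only [Finset.sum_range_succ, mul_add, Finset.sum_add_distrib] at h1 h2 ⊢
    push_cast
    linarith

/-- At a vertex the regulariser is -4√n, which telescopes into the increments √(t + 1) - √t.
Together these pay for the coordinate `i` of the penalty, as √(w_i) ≤ 1. -/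
theorem ftrl_regret_single_le [DecidableEq X] {w l : ℕ → X → ℝ} {D : ℕ → ℝ}
    (hstab : ∀ t, ∀ w' ∈ stdSimplex ℝ X, ∑ a, (w t a - w' a) * l t a
      ≤ D t + sqrtObjective (√((t : ℝ) + 1)) (fun a => ∑ s ∈ Finset.range t, l s a) w'
        - sqrtObjective (√((t : ℝ) + 1)) (fun a => ∑ s ∈ Finset.range t, l s a) (w t))
    (hw : ∀ t, w t ∈ stdSimplex ℝ X) (i : X) (n : ℕ) :
    ∑ t ∈ Finset.range n, (∑ a, w t a * l t a - l t i)
      ≤ ∑ t ∈ Finset.range n,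
        (D t + 4 / √((t : ℝ) + 1) * ∑ a ∈ Finset.univ.erase i, √(w t a)) := by
  have h := ftrl_regret_le hstab hw n _ (single_mem_stdSimplex ℝ i)
  have e : sqrtObjective (√(n : ℝ)) (fun a => ∑ s ∈ Finset.range n, l s a) (Pi.single i 1)
      = ∑ t ∈ Finset.range n, l t i - 4 * √(n : ℝ) := by
    have : ∀ a, √((Pi.single i 1 : X → ℝ) a) = if a = i then 1 else 0 := fun a => by
      by_cases ha : a = i
      · subst ha; simp
      · simp [ha]
    simp only [sqrtObjective, this]
    simp [Pi.single_apply]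
  have hn : √(n : ℝ) = ∑ t ∈ Finset.range n, (√((t : ℝ) + 1) - √t) := by
    have := Finset.sum_range_sub (fun t : ℕ => √(t : ℝ)) n
    push_cast at this
    simp [this]
  rw [e, hn, Finset.mul_sum] at h
  rw [Finset.sum_sub_distrib]
  have hle : ∑ t ∈ Finset.range n, (D t + 4 * (√((t : ℝ) + 1) - √t) * ∑ a, √(w t a))
      - ∑ t ∈ Finset.range n, 4 * (√((t : ℝ) + 1) - √t)
      ≤ ∑ t ∈ Finset.range n,
        (D t + 4 / √((t : ℝ) + 1) * ∑ a ∈ Finset.univ.erase i, √(w t a)) := by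
    rw [← Finset.sum_sub_distrib]
    refine Finset.sum_le_sum fun t _ => ?_
    rw [← Finset.add_sum_erase _ _ (Finset.mem_univ i)]
    have hi : √(w t i) ≤ 1 := Real.sqrt_le_one.2 (by
      rw [← (hw t).2]; exact Finset.single_le_sum (fun b _ => (hw t).1 b) (Finset.mem_univ i))
    have hS : 0 ≤ ∑ a ∈ Finset.univ.erase i, √(w t a) :=
      Finset.sum_nonneg fun _ _ => Real.sqrt_nonneg _
    have h0 : √(t : ℝ) ≤ √((t : ℝ) + 1) := Real.sqrt_le_sqrt (by linarith)
    have h1 : 0 < √((t : ℝ) + 1) := Real.sqrt_pos.2 (by positivity)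
    have hd : √((t : ℝ) + 1) - √t ≤ 1 / √((t : ℝ) + 1) := by
      rw [le_div_iff₀ h1]
      have := Real.sq_sqrt (show (0 : ℝ) ≤ (t : ℝ) + 1 by positivity)
      have := Real.sq_sqrt (show (0 : ℝ) ≤ (t : ℝ) by positivity)
      nlinarith [Real.sqrt_nonneg (t : ℝ)]
    have h2 := mul_le_mul_of_nonneg_right hd hS
    have h3 : (√((t : ℝ) + 1) - √t) * √(w t i) ≤ √((t : ℝ) + 1) - √t :=
      mul_le_of_le_one_right (by linarith) hi
    have h4 : 4 / √((t : ℝ) + 1) = 4 * (1 / √((t : ℝ) + 1)) := by ring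
    rw [h4]
    nlinarith
  linarith

end Ftrl

/-! ### Tsallis-INF as an instance, with importance-weighted losses. -/

section Tsallis

variable {X : Type*} [Fintype X]

open Classical in
/-- The importance-weighted loss estimator attached to `rewardEstimator`. -/
noncomputable def lossEstimator (p : X → ℝ) (x : X) (r : ℝ) (a : X) : ℝ :=
  if x = a then (1 - r) / p a else 0

/-- Reward and loss estimators add up to 1, so on the simplex the two objectives are opposite up to
a constant; 1/η and 1/α turn the entropy into 4√(t + 1) ∑ √w. -/
theorem IsTsallisINF.isMinOn {x : ℕ → X} {r : ℕ → ℝ} {p : ℕ → X → ℝ}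
    (h : IsTsallisINF (1 / 2) (fun t => 1 / (2 * Real.sqrt t)) x r p) (t : ℕ) :
    IsMinOn (sqrtObjective (√((t : ℝ) + 1))
      (fun a => ∑ s ∈ Finset.range t, lossEstimator (p s) (x s) (r s) a))
      (stdSimplex ℝ X) (p t) := by
  have key : ∀ w ∈ stdSimplex ℝ X,
      ∑ a, w a * ∑ s ∈ Finset.range t, rewardEstimator (p s) (x s) (r s) a
          + 1 / (1 / (2 * √((t + 1 : ℕ) : ℝ))) * tsallisEntropy (1 / 2) w
        = t - 4 * √((t : ℝ) + 1) - sqrtObjective (√((t : ℝ) + 1))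
          (fun a => ∑ s ∈ Finset.range t, lossEstimator (p s) (x s) (r s) a) w := by
    intro w hw
    have e1 : ∀ a, ∑ s ∈ Finset.range t, rewardEstimator (p s) (x s) (r s) a
        = t - ∑ s ∈ Finset.range t, lossEstimator (p s) (x s) (r s) a := by
      intro a
      rw [eq_sub_iff_add_eq, ← Finset.sum_add_distrib]
      have : ∀ s, rewardEstimator (p s) (x s) (r s) a + lossEstimator (p s) (x s) (r s) a = 1 :=
        fun s => by
          unfold rewardEstimator lossEstimator
          split_ifs <;> ring
      simp [this]
    simp only [e1, mul_sub, Finset.sum_sub_distrib, ← Finset.sum_mul, hw.2, tsallisEntropy,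
      ← Real.sqrt_eq_rpow, sqrtObjective]
    push_cast
    simp only [one_div_one_div]
    ring
  intro w hw
  have h1 := (h t).2 hw
  simp only [Set.mem_ofPred_eq] at h1 ⊢
  rw [key w hw, key _ (h t).1] at h1
  linarith

/-- The stability term of the round with index `t`, in which `a` was sampled from `q`, for the
comparator `i`. -/
noncomputable def stabilityTerm [DecidableEq X] (i : X) (t : ℕ) (q : X → ℝ) (a : X) : ℝ :=
  if a = i ∧ 3 ≤ t then
    (2 * (1 - q i) ^ 2 / √(q i) + 4 * ∑ j ∈ Finset.univ.erase i, √(q j) ^ 3) / √((t : ℝ) + 1)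
  else 2 / (√((t : ℝ) + 1) * √(q a))

theorem IsTsallisINF.pos {x : ℕ → X} {r : ℕ → ℝ} {p : ℕ → X → ℝ}
    (h : IsTsallisINF (1 / 2) (fun t => 1 / (2 * Real.sqrt t)) x r p) (t : ℕ) (a : X) :
    0 < p t a :=
  pos_of_isMinOn_sqrtObjective (Real.sqrt_pos.2 (by positivity)) (h t).1 (h.isMinOn t) a

theorem IsTsallisINF.regret_le [DecidableEq X] {x : ℕ → X} {r : ℕ → ℝ} {p : ℕ → X → ℝ}
    (h : IsTsallisINF (1 / 2) (fun t => 1 / (2 * Real.sqrt t)) x r p)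
    (hr : ∀ t, r t ∈ Set.Icc (-1 : ℝ) 1) (i : X) (n : ℕ) :
    ∑ t ∈ Finset.range n, ((1 - r t) - lossEstimator (p t) (x t) (r t) i)
      ≤ ∑ t ∈ Finset.range n, (stabilityTerm i t (p t) (x t)
        + 4 / √((t : ℝ) + 1) * ∑ a ∈ Finset.univ.erase i, √(p t a)) := by
  have hsum : ∀ t (v : X → ℝ), ∑ a, v a * lossEstimator (p t) (x t) (r t) a
      = v (x t) * ((1 - r t) / p t (x t)) := fun t v => by
    simp [lossEstimator]
  have := ftrl_regret_single_le (w := p) (l := fun t => lossEstimator (p t) (x t) (r t))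
    (D := fun t => stabilityTerm i t (p t) (x t)) ?_ (fun t => (h t).1) i n
  · refine le_trans (le_of_eq (Finset.sum_congr rfl fun t _ => ?_)) this
    rw [hsum, mul_div_cancel₀ _ (h.pos t _).ne']
  · intro t w' hw'
    rw [hsum t (fun a => p t a - w' a)]
    have hl : 1 - r t ∈ Set.Icc (0 : ℝ) 2 := ⟨by linarith [(hr t).2], by linarith [(hr t).1]⟩
    by_cases hc : x t = i ∧ 3 ≤ t
    · have hβ : 2 ≤ √((t : ℝ) + 1) := by
        apply Real.le_sqrt_of_sq_le
        have : (3 : ℝ) ≤ t := by exact_mod_cast hc.2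
        linarith
      have := stability_shifted hβ (h t).1 (h.isMinOn t) hw' hl (x t)
      rw [stabilityTerm, if_pos hc]
      rw [hc.1] at this ⊢
      exact this
    · rw [stabilityTerm, if_neg hc]
      exact stability (Real.sqrt_pos.2 (by positivity)) (h t).1 (h.isMinOn t) hw' hl (x t)

end Tsallis

/-! ### Integrating importance weights against conditional probabilities. -/

section Sampling

variable {Ω : Type*} {m m0 : MeasurableSpace Ω} {P : Measure Ω}

theorem aestronglyMeasurable_comp_pi {X : Type*} [Countable X] {p : Ω → X → ℝ}
    (hp : ∀ a, AEStronglyMeasurable[m] (fun ω => p ω a) P) {F : (X → ℝ) → ℝ}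
    (hF : Measurable F) : AEStronglyMeasurable[m] (fun ω => F (p ω)) P := by
  choose g hg hga using hp
  refine ⟨fun ω => F fun a => g a ω, ?_, ?_⟩
  · have hm : Measurable[m] fun ω a => g a ω :=
      @measurable_pi_lambda _ _ _ m _ _ fun a => (hg a).measurable
    exact (Measurable.comp (f := fun ω a => g a ω) hF hm).stronglyMeasurable
  · filter_upwards [ae_all_iff.2 hga] with ω hω
    exact congrArg F (funext hω)

variable [IsProbabilityMeasure P]

theorem trim_restrict_eq_withDensity (hm : m ≤ m0) {S : Set Ω} (hS : MeasurableSet S) :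
    (P.restrict S).trim hm
      = (P.trim hm).withDensity (fun ω => ENNReal.ofReal ((P⟦S | m⟧) ω)) := by
  have hint : Integrable (S.indicator fun _ => (1 : ℝ)) P := (integrable_const _).indicator hS
  have hnn : 0 ≤ᵐ[P] P⟦S | m⟧ :=
    condExp_nonneg (Filter.Eventually.of_forall fun ω => Set.indicator_nonneg (by simp) ω)
  refine @Measure.ext _ m _ _ fun A hA => ?_
  have hmeas : Measurable[m] fun ω => ENNReal.ofReal ((P⟦S | m⟧) ω) :=
    stronglyMeasurable_condExp.measurable.ennreal_ofReal
  rw [trim_measurableSet_eq hm hA, withDensity_apply _ hA, restrict_trim hm P hA,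
    lintegral_trim hm hmeas, ← ofReal_integral_eq_lintegral_ofReal
      integrable_condExp.integrableOn (ae_restrict_of_ae hnn), setIntegral_condExp hm hint hA,
    Measure.restrict_apply (hm A hA), setIntegral_indicator hS]
  simp

/-- Inverse probabilities may be unbounded, so integrability cannot be taken for granted. On `m`,
the restriction of `P` to `S` has density P(S | m), which turns the integral of |h| over `S` into
that of the product. -/
theorem integrableOn_of_integrable_condProb_mul (hm : m ≤ m0) {S : Set Ω} (hS : MeasurableSet S)
    {h : Ω → ℝ} (hh : StronglyMeasurable[m] h)
    (hint : Integrable (fun ω => (P⟦S | m⟧) ω * h ω) P) : IntegrableOn h S P := by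
  have hnn : 0 ≤ᵐ[P] P⟦S | m⟧ :=
    condExp_nonneg (Filter.Eventually.of_forall fun ω => Set.indicator_nonneg (by simp) ω)
  have hmeas : Measurable[m] fun ω => ENNReal.ofReal ((P⟦S | m⟧) ω) :=
    stronglyMeasurable_condExp.measurable.ennreal_ofReal
  refine ⟨(hh.mono hm).aestronglyMeasurable, ?_⟩
  have e : ∫⁻ ω, ‖h ω‖ₑ ∂(P.restrict S) = ∫⁻ ω, ‖(P⟦S | m⟧) ω * h ω‖ₑ ∂P := by
    rw [← lintegral_trim hm hh.enorm, trim_restrict_eq_withDensity hm hS,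
      lintegral_withDensity_eq_lintegral_mul _ hmeas hh.enorm,
      lintegral_trim hm (hmeas.mul hh.enorm)]
    refine lintegral_congr_ae ?_
    filter_upwards [hnn] with ω hω
    rw [Pi.mul_apply, enorm_mul, Real.enorm_of_nonneg hω]
  rw [HasFiniteIntegral, e]
  exact hint.2

/-- Integrating over an event against a function known before the event is decided. -/
theorem integral_indicator_of_condProb (hm : m ≤ m0) {S : Set Ω} (hS : MeasurableSet S)
    {q h : Ω → ℝ} (hq : P⟦S | m⟧ =ᵐ[P] q) (hh : AEStronglyMeasurable[m] h P)
    (hint : Integrable (fun ω => q ω * h ω) P) :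
    Integrable (S.indicator h) P ∧ ∫ ω, S.indicator h ω ∂P = ∫ ω, q ω * h ω ∂P := by
  obtain ⟨h', hh', hae⟩ := hh
  have hqh : (fun ω => q ω * h ω) =ᵐ[P] fun ω => (P⟦S | m⟧) ω * h' ω := by
    filter_upwards [hq, hae] with ω h1 h2
    rw [h1, h2]
  have hind : S.indicator h =ᵐ[P] h' * S.indicator (fun _ => (1 : ℝ)) := by
    filter_upwards [hae] with ω h2
    by_cases hω : ω ∈ S <;> simp [hω, h2]
  have hI : Integrable (h' * S.indicator (fun _ => (1 : ℝ))) P := by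
    have := (integrable_indicator_iff hS).2
      (integrableOn_of_integrable_condProb_mul hm hS hh' (hint.congr hqh))
    refine this.congr (Filter.Eventually.of_forall fun ω => ?_)
    by_cases hω : ω ∈ S <;> simp [hω]
  refine ⟨hI.congr hind.symm, ?_⟩
  rw [integral_congr_ae hind, ← integral_condExp hm, integral_congr_ae hqh]
  refine integral_congr_ae ((condExp_mul_of_stronglyMeasurable_left hh' hI
    ((integrable_const _).indicator hS)).trans (Filter.Eventually.of_forall fun ω => ?_))
  simp [mul_comm]

end Sampling

/-! ### Expectations along the repeated play. -/

section Play

variable {X Y Ω : Type*} {mΩ : MeasurableSpace Ω} {P : Measure Ω} {u : X → Y → ℝ} {ℱ : Filtration ℕ mΩ}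
  {x : ℕ → Ω → X} {y : ℕ → Ω → Y} {r : ℕ → Ω → ℝ} {p : ℕ → Ω → X → ℝ}

namespace IsPlay

theorem measurableSet_action (h : IsPlay P u ℱ x y r p) (t : ℕ) (a : X) :
    MeasurableSet (x t ⁻¹' {a}) :=
  ℱ.le _ _ (h.measurable_x t trivial)

theorem comap_y_le (h : IsPlay P u ℱ x y r p) (t : ℕ) :
    ℱ t ⊔ MeasurableSpace.comap (y t) ⊤ ≤ mΩ :=
  sup_le (ℱ.le _) (((h.measurable_y t).comap_le).trans (ℱ.le _))

theorem comap_xy_le (h : IsPlay P u ℱ x y r p) (t : ℕ) :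
    ℱ t ⊔ MeasurableSpace.comap (x t) ⊤ ⊔ MeasurableSpace.comap (y t) ⊤ ≤ mΩ :=
  sup_le (sup_le (ℱ.le _) (((h.measurable_x t).comap_le).trans (ℱ.le _)))
    (((h.measurable_y t).comap_le).trans (ℱ.le _))

/-- A strategy is only known to agree almost everywhere with a conditional probability, so
measurability holds only up to null sets. -/
theorem aestronglyMeasurable_strategy (h : IsPlay P u ℱ x y r p) (t : ℕ) (a : X) :
    AEStronglyMeasurable[ℱ t ⊔ MeasurableSpace.comap (y t) ⊤] (fun ω => p t ω a) P :=
  ⟨_, stronglyMeasurable_condExp, (h.sample t a).symm⟩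

theorem aestronglyMeasurable_comp_strategy [Finite X] (h : IsPlay P u ℱ x y r p) (t : ℕ)
    {F : (X → ℝ) → ℝ} (hF : Measurable F) :
    AEStronglyMeasurable[ℱ t ⊔ MeasurableSpace.comap (y t) ⊤] (fun ω => F (p t ω)) P :=
  aestronglyMeasurable_comp_pi (h.aestronglyMeasurable_strategy t) hF

variable [IsProbabilityMeasure P]

theorem integrable_reward (h : IsPlay P u ℱ x y r p) (t : ℕ) : Integrable (r t) P :=
  Integrable.of_bound ((h.measurable_r t).mono (ℱ.le _) le_rfl).aestronglyMeasurable 1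
    (Filter.Eventually.of_forall fun ω => abs_le.2 (h.reward_mem t ω))

theorem integral_reward (h : IsPlay P u ℱ x y r p) (t : ℕ) :
    ∫ ω, r t ω ∂P = ∫ ω, u (x t ω) (y t ω) ∂P := by
  rw [← integral_condExp (h.comap_xy_le t), integral_congr_ae (h.mean_reward t)]

theorem integrable_payoff [Fintype X] [Fintype Y] (h : IsPlay P u ℱ x y r p) (t : ℕ) (f : X → Y → ℝ) :
    Integrable (fun ω => f (x t ω) (y t ω)) P := by
  classical
  have e : (fun ω => f (x t ω) (y t ω)) = fun ω => ∑ a, ∑ b,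
      ((x t ⁻¹' {a}) ∩ (y t ⁻¹' {b})).indicator (fun _ => f a b) ω := by
    ext ω
    simp only [Set.indicator_apply, Set.mem_inter_iff, Set.mem_preimage, Set.mem_singleton_iff,
      ite_and]
    simp
  rw [e]
  exact integrable_finsetSum _ fun a _ => integrable_finsetSum _ fun b _ =>
    (integrable_const _).indicator
      ((h.measurableSet_action t a).inter (ℱ.le _ _ (h.measurable_y t trivial)))

variable [Fintype X]

theorem integrable_comp_strategy (h : IsPlay P u ℱ x y r p) (t : ℕ)
    {F : (X → ℝ) → ℝ} (hF : Measurable F) {K : ℝ} (hK : ∀ ω, |F (p t ω)| ≤ K) :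
    Integrable (fun ω => F (p t ω)) P :=
  Integrable.of_bound ((h.aestronglyMeasurable_comp_strategy t hF).mono (h.comap_y_le t)) K
    (Filter.Eventually.of_forall hK)

/-- The action sampled from `p t` integrates like `p t`. -/
theorem integral_sample (h : IsPlay P u ℱ x y r p) (t : ℕ)
    {F : X → (X → ℝ) → ℝ} (hF : ∀ a, Measurable (F a)) {K : ℝ}
    (hK : ∀ a ω, |p t ω a * F a (p t ω)| ≤ K) :
    Integrable (fun ω => F (x t ω) (p t ω)) P ∧
      ∫ ω, F (x t ω) (p t ω) ∂P = ∫ ω, ∑ a, p t ω a * F a (p t ω) ∂P := by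
  classical
  have hI : ∀ a, Integrable (fun ω => p t ω a * F a (p t ω)) P := fun a =>
    h.integrable_comp_strategy t (F := fun q => q a * F a q)
      ((measurable_pi_apply a).mul (hF a)) (hK a)
  have hL := fun a => integral_indicator_of_condProb (h.comap_y_le t)
    (h.measurableSet_action t a) (h.sample t a)
    (h.aestronglyMeasurable_comp_strategy t (hF a)) (hI a)
  have e : (fun ω => F (x t ω) (p t ω)) = fun ω => ∑ a,
      (x t ⁻¹' {a}).indicator (fun ω => F a (p t ω)) ω := by
    ext ω
    simp [Set.indicator_apply]
  rw [e]
  refine ⟨integrable_finsetSum _ fun a _ => (hL a).1, ?_⟩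
  rw [integral_finsetSum _ fun a _ => (hL a).1, integral_finsetSum _ fun a _ => hI a]
  exact Finset.sum_congr rfl fun a _ => (hL a).2

/-- Conditioning on both actions replaces the reward by `u`. Conditioning then on the history and
the adversary's action alone replaces the indicator of {x_t = a} by p_t(a), cancelling the weight.
-/
theorem integral_lossEstimator [Fintype Y] (h : IsPlay P u ℱ x y r p) (t : ℕ) (a : X)
    (hpos : ∀ ω, 0 < p t ω a) :
    Integrable (fun ω => lossEstimator (p t ω) (x t ω) (r t ω) a) P ∧
      ∫ ω, lossEstimator (p t ω) (x t ω) (r t ω) a ∂P = ∫ ω, (1 - u a (y t ω)) ∂P := by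
  classical
  set S := x t ⁻¹' {a} with hSdef
  have hS : MeasurableSet S := h.measurableSet_action t a
  have hle := h.comap_y_le t
  have hinv : AEStronglyMeasurable[ℱ t ⊔ MeasurableSpace.comap (y t) ⊤]
      (fun ω => (p t ω a)⁻¹) P :=
    h.aestronglyMeasurable_comp_strategy t (F := fun q => (q a)⁻¹)
      (measurable_pi_apply a).inv
  have hu : StronglyMeasurable[ℱ t ⊔ MeasurableSpace.comap (y t) ⊤]
      (fun ω => 1 - u a (y t ω)) := by
    have h1 : Measurable[MeasurableSpace.comap (y t) ⊤] (fun ω => 1 - u a (y t ω)) :=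
      @Measurable.comp _ _ _ (_) ⊤ _ (fun b => 1 - u a b) (y t) measurable_from_top
        (@comap_measurable _ _ ⊤ (y t))
    exact Measurable.stronglyMeasurable (h1.mono le_sup_right le_rfl)
  have e1 : (fun ω => p t ω a * (p t ω a)⁻¹) = fun _ => 1 := by
    ext ω; exact mul_inv_cancel₀ (hpos ω).ne'
  have e2 : (fun ω => p t ω a * ((p t ω a)⁻¹ * (1 - u a (y t ω)))) = fun ω => 1 - u a (y t ω) := by
    ext ω; rw [mul_inv_cancel_left₀ (hpos ω).ne']
  -- The weight on the event is integrable because its product with the probability is the constant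
  -- 1.
  have hL1 := integral_indicator_of_condProb hle hS (h.sample t a) hinv
    (by rw [e1]; exact integrable_const _)
  have hL2 := integral_indicator_of_condProb hle hS (h.sample t a)
    (hinv.mul hu.aestronglyMeasurable)
    (by
      change Integrable (fun ω => p t ω a * ((p t ω a)⁻¹ * (1 - u a (y t ω)))) P
      rw [e2]; exact h.integrable_payoff t fun _ b => 1 - u a b)
  have hr : Integrable (fun ω => 1 - r t ω) P := (integrable_const _).sub (h.integrable_reward t)
  have e3 : (fun ω => lossEstimator (p t ω) (x t ω) (r t ω) a)
      = S.indicator (fun ω => (p t ω a)⁻¹) * fun ω => 1 - r t ω := by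
    ext ω
    by_cases hω : x t ω = a
    · simp [lossEstimator, hω, S, div_eq_inv_mul]
    · simp [lossEstimator, hω, S]
  have hI : Integrable (S.indicator (fun ω => (p t ω a)⁻¹) * fun ω => 1 - r t ω) P := by
    refine hL1.1.mul_bdd (c := 2) hr.aestronglyMeasurable
      (Filter.Eventually.of_forall fun ω => ?_)
    have := h.reward_mem t ω
    rw [Real.norm_eq_abs, abs_le]
    constructor <;> linarith [this.1, this.2]
  rw [e3]
  refine ⟨hI, ?_⟩
  have hmeas : AEStronglyMeasurable[ℱ t ⊔ MeasurableSpace.comap (x t) ⊤ ⊔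
      MeasurableSpace.comap (y t) ⊤] (S.indicator (fun ω => (p t ω a)⁻¹)) P := by
    obtain ⟨g, hg, hga⟩ := hinv
    refine ⟨S.indicator g, StronglyMeasurable.indicator
      (hg.mono (sup_le_sup_right (le_sup_left : ℱ t ≤ ℱ t ⊔ MeasurableSpace.comap (x t) ⊤) _))
      ?_, ?_⟩
    · exact (le_sup_right.trans le_sup_left : MeasurableSpace.comap (x t) ⊤ ≤ _) _
        ⟨{a}, trivial, rfl⟩
    · filter_upwards [hga] with ω hω
      simp [Set.indicator_apply, hω]
  have hc := condExp_mul_of_aestronglyMeasurable_left hmeas hI hr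
  have hc2 : P[fun ω => 1 - r t ω | ℱ t ⊔ MeasurableSpace.comap (x t) ⊤ ⊔
      MeasurableSpace.comap (y t) ⊤] =ᵐ[P] fun ω => 1 - u (x t ω) (y t ω) := by
    refine (condExp_sub (integrable_const (1 : ℝ)) (h.integrable_reward t) _).trans ?_
    filter_upwards [h.mean_reward t] with ω hω
    rw [Pi.sub_apply, hω, condExp_const (h.comap_xy_le t)]
  rw [← integral_condExp (h.comap_xy_le t), integral_congr_ae hc]
  have e4 : S.indicator (fun ω => (p t ω a)⁻¹) * P[fun ω => 1 - r t ω | ℱ t ⊔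
      MeasurableSpace.comap (x t) ⊤ ⊔ MeasurableSpace.comap (y t) ⊤] =ᵐ[P]
      S.indicator (fun ω => (p t ω a)⁻¹ * (1 - u a (y t ω))) := by
    filter_upwards [hc2] with ω hω
    rw [Pi.mul_apply, hω]
    by_cases hx : x t ω = a
    · simp [S, hx]
    · simp [S, hx]
  rw [integral_congr_ae e4]
  refine hL2.2.trans ?_
  exact congrArg (fun f : Ω → ℝ => ∫ ω, f ω ∂P) e2

end IsPlay

/-! ### The stability term averaged over the sampled action. -/

section Stability

variable [Fintype X] [DecidableEq X]

theorem measurable_stabilityTerm (i : X) (t : ℕ) (a : X) :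
    Measurable fun q : X → ℝ => stabilityTerm i t q a := by
  unfold stabilityTerm
  split_ifs <;> fun_prop

theorem stabilityTerm_nonneg (i : X) (t : ℕ) (q : X → ℝ) (a : X) : 0 ≤ stabilityTerm i t q a := by
  unfold stabilityTerm
  split_ifs <;> positivity

/-- An action a ≠ i contributes 2√(q_a)/β. For `i` the shifted bound contributes at most 6/β times
the same sum of roots, because 1 - q_i is the mass of the other actions. Before index 3 the crude
bound for `i` costs at most 2. -/
theorem sum_mul_stabilityTerm_le (i : X) (t : ℕ) {q : X → ℝ} (hq : q ∈ stdSimplex ℝ X) :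
    ∑ a, q a * stabilityTerm i t q a
      ≤ 8 / √((t : ℝ) + 1) * ∑ a ∈ Finset.univ.erase i, √(q a) + if t < 3 then 2 else 0 := by
  have hβ : 1 ≤ √((t : ℝ) + 1) := Real.one_le_sqrt.2 (by linarith [(Nat.cast_nonneg t : (0:ℝ) ≤ t)])
  set β := √((t : ℝ) + 1) with hβdef
  have hle1 : ∀ a, q a ≤ 1 := fun a => by
    rw [← hq.2]; exact Finset.single_le_sum (fun b _ => hq.1 b) (Finset.mem_univ a)
  have hsle1 : ∀ a, √(q a) ≤ 1 := fun a => Real.sqrt_le_one.2 (hle1 a)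
  have hmain : ∀ a, q a * (2 / (β * √(q a))) = 2 / β * √(q a) := fun a => by
    rcases (Real.sqrt_nonneg (q a)).eq_or_lt with h0 | h0
    · simp [← h0]
    · nth_rewrite 1 [← Real.sq_sqrt (hq.1 a)]
      field_simp
  set s := ∑ a ∈ Finset.univ.erase i, √(q a) with hs
  have hs0 : 0 ≤ s := Finset.sum_nonneg fun _ _ => Real.sqrt_nonneg _
  have hrest : ∑ a ∈ Finset.univ.erase i, q a * stabilityTerm i t q a = 2 / β * s := by
    rw [hs, Finset.mul_sum]
    refine Finset.sum_congr rfl fun a ha => ?_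
    rw [stabilityTerm, if_neg (fun h => Finset.ne_of_mem_erase ha h.1), hmain]
  rw [← Finset.add_sum_erase _ _ (Finset.mem_univ i), hrest]
  by_cases ht : t < 3
  · rw [stabilityTerm, if_neg (fun h => by omega), hmain, if_pos ht]
    have h1 : 2 / β ≤ 2 := by
      rw [div_le_iff₀ (by positivity)]; linarith
    have h2 : 2 / β * √(q i) ≤ 2 * 1 :=
      mul_le_mul h1 (hsle1 i) (Real.sqrt_nonneg _) (by norm_num)
    have h3 : 2 / β * s ≤ 8 / β * s := by gcongr; norm_num
    linarith
  · rw [stabilityTerm, if_pos ⟨rfl, by omega⟩, if_neg ht, add_zero]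
    have h1 : q i * (2 * (1 - q i) ^ 2 / √(q i)) ≤ 2 * s := by
      have hsum := hq.2
      rw [← Finset.add_sum_erase _ _ (Finset.mem_univ i)] at hsum
      have hle : 1 - q i ≤ s := by
        have : ∑ a ∈ Finset.univ.erase i, q a ≤ s := Finset.sum_le_sum fun a _ =>
          Real.le_sqrt_of_sq_le (by nlinarith [hq.1 a, hle1 a])
        linarith
      have e : q i * (2 * (1 - q i) ^ 2 / √(q i)) = √(q i) * (1 - q i) * (2 * (1 - q i)) := by
        rcases (Real.sqrt_nonneg (q i)).eq_or_lt with h0 | h0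
        · simp [← h0]
        · nth_rewrite 1 [← Real.sq_sqrt (hq.1 i)]
          field_simp
      rw [e]
      have h4 : √(q i) * (1 - q i) ≤ 1 :=
        mul_le_one₀ (hsle1 i) (by linarith [hle1 i]) (by linarith [hq.1 i])
      have h5 := mul_le_mul_of_nonneg_right h4 (by linarith [hle1 i] : 0 ≤ 2 * (1 - q i))
      linarith
    have h2 : q i * (4 * ∑ j ∈ Finset.univ.erase i, √(q j) ^ 3) ≤ 4 * s := by
      have h3 : ∑ j ∈ Finset.univ.erase i, √(q j) ^ 3 ≤ s := Finset.sum_le_sum fun a _ =>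
        pow_le_of_le_one (Real.sqrt_nonneg _) (hsle1 a) (by norm_num)
      have h4 : 0 ≤ ∑ j ∈ Finset.univ.erase i, √(q j) ^ 3 :=
        Finset.sum_nonneg fun _ _ => by positivity
      nlinarith [hq.1 i, hle1 i]
    have h3 : q i * ((2 * (1 - q i) ^ 2 / √(q i)
        + 4 * ∑ j ∈ Finset.univ.erase i, √(q j) ^ 3) / β) ≤ 6 * s / β := by
      rw [← mul_div_assoc, mul_add]
      gcongr
      linarith
    calc _ ≤ 6 * s / β + 2 / β * s := by
          refine add_le_add ?_ le_rfl
          exact h3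
      _ = 8 / β * s := by ring

theorem sum_sqrt_le {q : X → ℝ} (hq : q ∈ stdSimplex ℝ X) (i : X) :
    ∑ a ∈ Finset.univ.erase i, √(q a) ≤ √(Fintype.card X) := by
  have h1 : ∑ a ∈ Finset.univ.erase i, √(q a) ≤ ∑ a, √(q a) :=
    Finset.sum_le_sum_of_subset_of_nonneg (Finset.subset_univ _) fun _ _ _ => Real.sqrt_nonneg _
  refine h1.trans (Real.le_sqrt_of_sq_le ?_)
  have := sq_sum_le_card_mul_sum_sq (s := Finset.univ) (f := fun a => √(q a))
  simpa [Real.sq_sqrt (hq.1 _), hq.2] using this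

end Stability

/-- The expected regret of Tsallis-INF against the fixed action `i`. -/
theorem IsPlay.regret_le [Fintype X] [DecidableEq X] [Fintype Y] [IsProbabilityMeasure P]
    (h : IsPlay P u ℱ x y r p)
    (halg : ∀ ω, IsTsallisINF (1 / 2) (fun t => 1 / (2 * Real.sqrt t))
      (fun t => x t ω) (fun t => r t ω) (fun t => p t ω)) (i : X) (T : ℕ) :
    ∫ ω, ∑ t ∈ Finset.range T, (u i (y t ω) - u (x t ω) (y t ω)) ∂P
      ≤ ∑ t ∈ Finset.range T,
        12 / √((t : ℝ) + 1) * ∫ ω, ∑ a ∈ Finset.univ.erase i, √(p t ω a) ∂P + 6 := by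
  have hmem : ∀ t ω, p t ω ∈ stdSimplex ℝ X := fun t ω => (halg ω t).1
  have hloss := fun t => h.integral_lossEstimator t i (fun ω => (halg ω).pos t i)
  have hs0 : ∀ t ω, 0 ≤ ∑ a ∈ Finset.univ.erase i, √(p t ω a) := fun t ω =>
    Finset.sum_nonneg fun _ _ => Real.sqrt_nonneg _
  have hsI : ∀ t, Integrable (fun ω => ∑ a ∈ Finset.univ.erase i, √(p t ω a)) P := fun t =>
    h.integrable_comp_strategy t (F := fun q => ∑ a ∈ Finset.univ.erase i, √(q a))
      (by fun_prop) (K := √(Fintype.card X)) fun ω => by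
        rw [abs_of_nonneg (hs0 t ω)]; exact sum_sqrt_le (hmem t ω) i
  have hnn : ∀ t ω a, 0 ≤ p t ω a * stabilityTerm i t (p t ω) a := fun t ω a =>
    mul_nonneg ((hmem t ω).1 a) (stabilityTerm_nonneg _ _ _ _)
  have hstab := fun t => h.integral_sample t (F := fun a q => stabilityTerm i t q a)
    (K := 8 * √(Fintype.card X) + 2) (measurable_stabilityTerm i t) fun a ω => by
      rw [abs_of_nonneg (hnn t ω a)]
      have h1 := Finset.single_le_sum (fun b _ => hnn t ω b) (Finset.mem_univ a)
      have h2 := sum_mul_stabilityTerm_le i t (hmem t ω)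
      have h3 : 8 / √((t : ℝ) + 1) * ∑ a ∈ Finset.univ.erase i, √(p t ω a)
          ≤ 8 * √(Fintype.card X) := by
        refine mul_le_mul (div_le_self (by norm_num) ?_) (sum_sqrt_le (hmem t ω) i)
          (hs0 t ω) (by norm_num)
        exact Real.one_le_sqrt.2 (by linarith [(Nat.cast_nonneg t : (0:ℝ) ≤ t)])
      have h4 : (if t < 3 then 2 else 0 : ℝ) ≤ 2 := by split_ifs <;> norm_num
      exact h1.trans (h2.trans (by linarith))
  have hstabI : ∀ t, Integrable (fun ω => ∑ a, p t ω a * stabilityTerm i t (p t ω) a) P := by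
    intro t
    refine h.integrable_comp_strategy t (F := fun q => ∑ a, q a * stabilityTerm i t q a)
      (Finset.measurable_sum _ fun a _ => (measurable_pi_apply a).mul
        (measurable_stabilityTerm i t a)) (K := 8 * √(Fintype.card X) + 2) fun ω => ?_
    rw [abs_of_nonneg (Finset.sum_nonneg fun a _ => hnn t ω a)]
    have h2 := sum_mul_stabilityTerm_le i t (hmem t ω)
    have h3 : 8 / √((t : ℝ) + 1) * ∑ a ∈ Finset.univ.erase i, √(p t ω a)
        ≤ 8 * √(Fintype.card X) := by
      refine mul_le_mul (div_le_self (by norm_num) ?_) (sum_sqrt_le (hmem t ω) i)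
        (hs0 t ω) (by norm_num)
      exact Real.one_le_sqrt.2 (by linarith [(Nat.cast_nonneg t : (0:ℝ) ≤ t)])
    have h4 : (if t < 3 then 2 else 0 : ℝ) ≤ 2 := by split_ifs <;> norm_num
    exact h2.trans (by linarith)
  have hstab_le : ∀ t, ∫ ω, stabilityTerm i t (p t ω) (x t ω) ∂P
      ≤ 8 / √((t : ℝ) + 1) * ∫ ω, ∑ a ∈ Finset.univ.erase i, √(p t ω a) ∂P
        + if t < 3 then 2 else 0 := by
    intro t
    rw [(hstab t).2]
    have hI : Integrable (fun ω => 8 / √((t : ℝ) + 1) * ∑ a ∈ Finset.univ.erase i, √(p t ω a)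
        + if t < 3 then 2 else 0) P := ((hsI t).const_mul _).add (integrable_const _)
    refine (integral_mono (hstabI t) hI
      fun ω => sum_mul_stabilityTerm_le i t (hmem t ω)).trans ?_
    rw [integral_add ((hsI t).const_mul _) (integrable_const _), integral_const_mul]
    simp
  have hrI : ∀ t, Integrable (fun ω => 1 - r t ω) P := fun t =>
    (integrable_const _).sub (h.integrable_reward t)
  have hlI : ∀ t, Integrable
      (fun ω => (1 - r t ω) - lossEstimator (p t ω) (x t ω) (r t ω) i) P := fun t =>
    (hrI t).sub (hloss t).1
  have hbI : ∀ t, Integrable (fun ω => stabilityTerm i t (p t ω) (x t ω)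
      + 4 / √((t : ℝ) + 1) * ∑ a ∈ Finset.univ.erase i, √(p t ω a)) P := fun t =>
    (hstab t).1.add ((hsI t).const_mul (4 / √((t : ℝ) + 1)))
  have hpath := integral_mono
    (integrable_finsetSum (Finset.range T) fun t _ => hlI t)
    (integrable_finsetSum (Finset.range T) fun t _ => hbI t)
    fun ω => (halg ω).regret_le (fun t => h.reward_mem t ω) i T
  rw [integral_finsetSum _ fun t _ => hlI t, integral_finsetSum _ fun t _ => hbI t] at hpath
  rw [integral_finsetSum _ fun t _ => h.integrable_payoff t fun a b => u i b - u a b]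
  have e1 : ∀ t, ∫ ω, ((1 - r t ω) - lossEstimator (p t ω) (x t ω) (r t ω) i) ∂P
      = ∫ ω, (u i (y t ω) - u (x t ω) (y t ω)) ∂P := by
    intro t
    rw [integral_sub (hrI t) (hloss t).1, (hloss t).2,
      integral_sub (integrable_const _) (h.integrable_reward t), h.integral_reward t,
      integral_sub (integrable_const _) (h.integrable_payoff t fun _ b => u i b),
      integral_sub (h.integrable_payoff t fun _ b => u i b) (h.integrable_payoff t u)]
    ring
  have e2 : ∀ t, ∫ ω, (stabilityTerm i t (p t ω) (x t ω)
        + 4 / √((t : ℝ) + 1) * ∑ a ∈ Finset.univ.erase i, √(p t ω a)) ∂P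
      ≤ 12 / √((t : ℝ) + 1) * ∫ ω, ∑ a ∈ Finset.univ.erase i, √(p t ω a) ∂P
        + if t < 3 then 2 else 0 := by
    intro t
    rw [integral_add (hstab t).1 ((hsI t).const_mul _), integral_const_mul]
    refine (add_le_add_left (hstab_le t) _).trans (le_of_eq ?_)
    ring
  -- The three early rounds cost 2 each.
  have hsix : ∑ t ∈ Finset.range T, (if t < 3 then 2 else 0 : ℝ) ≤ 6 := by
    rw [← Finset.sum_filter, Finset.sum_const, nsmul_eq_mul]
    have : (Finset.filter (fun t => t < 3) (Finset.range T)).card ≤ 3 := by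
      refine (Finset.card_le_card (t := Finset.range 3) fun t ht => ?_).trans (by simp)
      simp at ht ⊢; exact ht.2
    have : ((Finset.filter (fun t => t < 3) (Finset.range T)).card : ℝ) ≤ 3 := by
      exact_mod_cast this
    linarith
  calc _ = ∑ t ∈ Finset.range T,
        ∫ ω, ((1 - r t ω) - lossEstimator (p t ω) (x t ω) (r t ω) i) ∂P :=
        Finset.sum_congr rfl fun t _ => (e1 t).symm
    _ ≤ _ := hpath
    _ ≤ _ := Finset.sum_le_sum fun t _ => e2 t
    _ ≤ _ := by rw [Finset.sum_add_distrib]; linarith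

end Play

/-! ### Elementary sums, then game values and gaps. -/

section Sums

theorem sum_one_div_sqrt_le (T : ℕ) :
    ∑ t ∈ Finset.range T, 1 / √((t : ℝ) + 1) ≤ 2 * √(T : ℝ) := by
  induction T with
  | zero => simp
  | succ n ih =>
    rw [Finset.sum_range_succ]
    push_cast
    have h1 : 0 < √((n : ℝ) + 1) := Real.sqrt_pos.2 (by positivity)
    have h2 := Real.sq_sqrt (show (0 : ℝ) ≤ (n : ℝ) + 1 by positivity)
    have h3 := Real.sq_sqrt (show (0 : ℝ) ≤ (n : ℝ) by positivity)
    have h4 : 1 / √((n : ℝ) + 1) ≤ 2 * (√((n : ℝ) + 1) - √(n : ℝ)) := by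
      rw [div_le_iff₀ h1]
      nlinarith [sq_nonneg (√((n : ℝ) + 1) - √(n : ℝ))]
    linarith

theorem log_ge_of_two_le {T : ℕ} (hT : 2 ≤ T) : 2 / 3 ≤ Real.log T := by
  have h1 : Real.log 2 ≤ Real.log T :=
    Real.log_le_log (by norm_num) (by exact_mod_cast hT)
  linarith [Real.log_two_gt_d9]

theorem sum_one_div_le_log {T : ℕ} (hT : 2 ≤ T) :
    ∑ t ∈ Finset.range T, 1 / ((t : ℝ) + 1) ≤ 3 * Real.log T := by
  have h1 := harmonic_le_one_add_log T
  have h2 : ((harmonic T : ℚ) : ℝ) = ∑ t ∈ Finset.range T, 1 / ((t : ℝ) + 1) := by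
    simp [harmonic]
  linarith [log_ge_of_two_le hT]

end Sums

section Values

variable {X Y : Type*}

theorem exists_vStar_le [Finite X] [Finite Y] [Nonempty X] (u : X → Y → ℝ) :
    ∃ a, ∀ b, vStar u ≤ u a b := by
  obtain ⟨a, ha⟩ := exists_eq_ciSup_of_finite (f := fun a => ⨅ b, u a b)
  refine ⟨a, fun b => ?_⟩
  rw [vStar, ← ha]
  exact ciInf_le (Set.finite_range _).bddBelow b

theorem IsPSNE.vStar_eq [Finite X] [Finite Y] {u : X → Y → ℝ} {xs : X} {ys : Y}
    (h : IsPSNE u xs ys) : vStar u = u xs ys := by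
  have : Nonempty X := ⟨xs⟩
  have : Nonempty Y := ⟨ys⟩
  refine le_antisymm (ciSup_le fun a => ?_) ?_
  · exact (ciInf_le (Set.finite_range _).bddBelow ys).trans (h.1 a)
  · exact (le_ciInf h.2).trans (le_ciSup (f := fun a => ⨅ b, u a b)
      (Set.finite_range _).bddAbove xs)

theorem IsStrictPSNE.isPSNE {u : X → Y → ℝ} {xs : X} {ys : Y} (h : IsStrictPSNE u xs ys) :
    IsPSNE u xs ys := by
  refine ⟨fun a => ?_, fun b => ?_⟩
  · rcases eq_or_ne a xs with rfl | ha
    · exact le_rfl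
    · exact (h.1 a ha).le
  · rcases eq_or_ne b ys with rfl | hb
    · exact le_rfl
    · exact (h.2 b hb).le

theorem minColGap_le [Finite Y] (u : X → Y → ℝ) (xs : X) {ys b : Y} (hb : b ≠ ys) :
    minColGap u xs ys ≤ colGap u xs ys b :=
  ciInf_le (f := fun b : {b : Y // b ≠ ys} => colGap u xs ys b)
    (Set.finite_range _).bddBelow ⟨b, hb⟩

theorem IsStrictPSNE.minColGap_pos [Finite Y] [Nontrivial Y] {u : X → Y → ℝ} {xs : X} {ys : Y}
    (h : IsStrictPSNE u xs ys) : 0 < minColGap u xs ys := by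
  obtain ⟨b, hb⟩ := exists_ne ys
  have : Nonempty {b : Y // b ≠ ys} := ⟨⟨b, hb⟩⟩
  obtain ⟨c, hc⟩ := exists_eq_ciInf_of_finite (f := fun b : {b : Y // b ≠ ys} => colGap u xs ys b)
  rw [minColGap, ← hc]
  exact sub_pos.2 (h.2 c c.2)

theorem rowGap_le_two {u : X → Y → ℝ}
    (hu : ∀ a b, u a b ∈ Set.Icc (-1 : ℝ) 1) (xs : X) (ys : Y) (a : X) :
    rowGap u xs ys a ≤ 2 := by
  unfold rowGap
  linarith [(hu xs ys).2, (hu a ys).1]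

theorem sum_log_div_rowGap_nonneg [Fintype X] [DecidableEq X] {u : X → Y → ℝ}
    {xs : X} {ys : Y} (hs : IsStrictPSNE u xs ys) (T : ℕ) :
    0 ≤ ∑ a ∈ Finset.univ.erase xs, Real.log T / rowGap u xs ys a :=
  Finset.sum_nonneg fun a ha =>
    div_nonneg (Real.log_natCast_nonneg T) (sub_pos.2 (hs.1 a (Finset.ne_of_mem_erase ha))).le

theorem IsMSNE.vMix_le [Fintype X] [Fintype Y] {u : X → Y → ℝ} {ps : X → ℝ} {qs : Y → ℝ}
    (h : IsMSNE u ps qs) (b : Y) : vMix u ≤ ∑ a, ps a * u a b := by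
  classical
  rw [← h.mixedUtility_eq]
  refine (h.2.2.2 _ (single_mem_stdSimplex ℝ b)).trans (le_of_eq ?_)
  simp [mixedUtility, Pi.single_apply]

end Values

/-! ### From external regret to maximin regret. -/

section Play

variable {X Y Ω : Type*} [Fintype X] [DecidableEq X] {mΩ : MeasurableSpace Ω}
  {P : Measure Ω} [IsProbabilityMeasure P] {u : X → Y → ℝ} {ℱ : Filtration ℕ mΩ}
  {x : ℕ → Ω → X} {y : ℕ → Ω → Y} {r : ℕ → Ω → ℝ} {p : ℕ → Ω → X → ℝ}

theorem IsPlay.integrable_sqrt_strategy (h : IsPlay P u ℱ x y r p)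
    (hp : ∀ t ω, p t ω ∈ stdSimplex ℝ X) (i : X) (t : ℕ) :
    Integrable (fun ω => ∑ a ∈ Finset.univ.erase i, √(p t ω a)) P :=
  h.integrable_comp_strategy t (F := fun q => ∑ a ∈ Finset.univ.erase i, √(q a))
    (by fun_prop) (K := √(Fintype.card X)) fun ω => by
      rw [abs_of_nonneg (Finset.sum_nonneg fun _ _ => Real.sqrt_nonneg _)]
      exact sum_sqrt_le (hp t ω) i

variable [Fintype Y]

theorem IsPlay.regret_le_sqrt (h : IsPlay P u ℱ x y r p)
    (halg : ∀ ω, IsTsallisINF (1 / 2) (fun t => 1 / (2 * Real.sqrt t))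
      (fun t => x t ω) (fun t => r t ω) (fun t => p t ω)) (i : X) (T : ℕ) :
    ∫ ω, ∑ t ∈ Finset.range T, (u i (y t ω) - u (x t ω) (y t ω)) ∂P
      ≤ 30 * √(Fintype.card X * T) := by
  rcases T.eq_zero_or_pos with rfl | hT
  · simp
  have hmem : ∀ t ω, p t ω ∈ stdSimplex ℝ X := fun t ω => (halg ω t).1
  refine (h.regret_le halg i T).trans ?_
  have h1 : ∀ t, ∫ ω, ∑ a ∈ Finset.univ.erase i, √(p t ω a) ∂P ≤ √(Fintype.card X) := fun t => by
    refine (integral_mono (h.integrable_sqrt_strategy hmem i t) (integrable_const _)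
      fun ω => sum_sqrt_le (hmem t ω) i).trans ?_
    simp
  have h2 : ∑ t ∈ Finset.range T, 12 / √((t : ℝ) + 1)
        * ∫ ω, ∑ a ∈ Finset.univ.erase i, √(p t ω a) ∂P
      ≤ 12 * √(Fintype.card X) * ∑ t ∈ Finset.range T, 1 / √((t : ℝ) + 1) := by
    rw [Finset.mul_sum]
    refine Finset.sum_le_sum fun t _ => ?_
    refine (mul_le_mul_of_nonneg_left (h1 t) (by positivity)).trans (le_of_eq ?_)
    ring
  have h3 := mul_le_mul_of_nonneg_left (sum_one_div_sqrt_le T)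
    (by positivity : 0 ≤ 12 * √(Fintype.card X : ℝ))
  -- This absorbs the additive 6 into the leading term: 12 · 2 + 6 = 30.
  have h4 : 1 ≤ √(Fintype.card X * T : ℝ) := by
    rw [Real.one_le_sqrt]
    have hX : 0 < Fintype.card X := Fintype.card_pos_iff.2 ⟨i⟩
    exact_mod_cast Nat.mul_pos hX hT
  rw [Real.sqrt_mul (by positivity)] at h4 ⊢
  linarith

theorem IsPlay.psmr_le_sqrt [Nonempty X] (h : IsPlay P u ℱ x y r p)
    (halg : ∀ ω, IsTsallisINF (1 / 2) (fun t => 1 / (2 * Real.sqrt t))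
      (fun t => x t ω) (fun t => r t ω) (fun t => p t ω)) (T : ℕ) :
    psmr P u x y T ≤ 30 * √(Fintype.card X * T) := by
  obtain ⟨i, hi⟩ := exists_vStar_le u
  refine le_trans (integral_mono
    (integrable_finsetSum _ fun t _ => h.integrable_payoff t fun a b => vStar u - u a b)
    (integrable_finsetSum _ fun t _ => h.integrable_payoff t fun a b => u i b - u a b)
    fun ω => Finset.sum_le_sum fun t _ => ?_) (h.regret_le_sqrt halg i T)
  linarith [hi (y t ω)]

theorem IsPlay.psmr_le_div_mixGap [Nonempty X] [Nonempty Y] (h : IsPlay P u ℱ x y r p)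
    (halg : ∀ ω, IsTsallisINF (1 / 2) (fun t => 1 / (2 * Real.sqrt t))
      (fun t => x t ω) (fun t => r t ω) (fun t => p t ω)) (hgap : 0 < mixGap u) (T : ℕ) :
    psmr P u x y T ≤ 225 * (Fintype.card X / mixGap u) := by
  obtain ⟨ps, qs, hne⟩ := exists_isMSNE u
  have hreg : ∀ a t, Integrable (fun ω => u a (y t ω) - u (x t ω) (y t ω)) P := fun a t =>
    h.integrable_payoff t fun a' b => u a b - u a' b
  have hsum : ∀ a, Integrable
      (fun ω => ps a * ∑ t ∈ Finset.range T, (u a (y t ω) - u (x t ω) (y t ω))) P := fun a =>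
    (integrable_finsetSum _ fun t _ => hreg a t).const_mul _
  have h1 : psmr P u x y T ≤ ∫ ω, (∑ a, ps a * ∑ t ∈ Finset.range T,
      (u a (y t ω) - u (x t ω) (y t ω)) - T * mixGap u) ∂P := by
    refine integral_mono
      (integrable_finsetSum _ fun t _ => h.integrable_payoff t fun a b => vStar u - u a b)
      ((integrable_finsetSum _ fun a _ => hsum a).sub (integrable_const _)) fun ω => ?_
    have e : ∑ a, ps a * ∑ t ∈ Finset.range T, (u a (y t ω) - u (x t ω) (y t ω)) - T * mixGap u
        = ∑ t ∈ Finset.range T, (∑ a, ps a * u a (y t ω) - u (x t ω) (y t ω) - mixGap u) := by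
      simp only [Finset.mul_sum]
      rw [Finset.sum_comm]
      simp only [mul_sub, Finset.sum_sub_distrib, ← Finset.sum_mul, hne.1.2]
      simp
    simp only [e]
    refine Finset.sum_le_sum fun t _ => ?_
    have := hne.vMix_le (y t ω)
    simp only [mixGap]
    linarith
  rw [integral_sub (integrable_finsetSum _ fun a _ => hsum a) (integrable_const _),
    integral_finsetSum _ fun a _ => hsum a] at h1
  simp only [integral_const_mul, integral_const, probReal_univ, one_smul] at h1
  have h2 : ∑ a, ps a * ∫ ω, ∑ t ∈ Finset.range T, (u a (y t ω) - u (x t ω) (y t ω)) ∂P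
      ≤ ∑ a, ps a * (30 * √(Fintype.card X * T)) :=
    Finset.sum_le_sum fun a _ =>
      mul_le_mul_of_nonneg_left (h.regret_le_sqrt halg a T) (hne.1.1 a)
  rw [← Finset.sum_mul, hne.1.2, one_mul, Real.sqrt_mul (by positivity)] at h2
  refine (h1.trans (sub_le_sub_right h2 _)).trans ?_
  have h3 := Real.sq_sqrt (show (0 : ℝ) ≤ Fintype.card X by positivity)
  have h4 := Real.sq_sqrt (show (0 : ℝ) ≤ T by positivity)
  generalize √(Fintype.card X : ℝ) = c at *
  generalize √(T : ℝ) = d at *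
  rw [← h3, ← h4, ← mul_div_assoc, le_div_iff₀ hgap]
  -- With c² = m_x and d² = T, this is 30cd - d²Δ ≤ 225c²/Δ.
  nlinarith [sq_nonneg (15 * c - d * mixGap u)]

/-- A pointwise self-bounding inequality turns the regret bound into a logarithmic one. -/
theorem IsPlay.psmr_le_log (h : IsPlay P u ℱ x y r p)
    (halg : ∀ ω, IsTsallisINF (1 / 2) (fun t => 1 / (2 * Real.sqrt t))
      (fun t => x t ω) (fun t => r t ω) (fun t => p t ω)) {i : X} {g : X → ℝ} {κ : ℝ}
    (hgi : g i = 0) (hg : ∀ a, a ≠ i → 0 < g a) (hg2 : ∀ a, g a ≤ 2) (hκ : 0 < κ) (hκ1 : κ ≤ 1)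
    (hself : ∀ a b, vStar u - u a b ≤ (1 + κ) * (u i b - u a b) - κ * g a)
    {T : ℕ} (hT : 2 ≤ T) :
    psmr P u x y T ≤ 468 / κ * ∑ a ∈ Finset.univ.erase i, Real.log T / g a := by
  have hmem : ∀ t ω, p t ω ∈ stdSimplex ℝ X := fun t ω => (halg ω t).1
  have hlog := log_ge_of_two_le hT
  have hvI : Integrable (fun ω => ∑ t ∈ Finset.range T, (vStar u - u (x t ω) (y t ω))) P :=
    integrable_finsetSum _ fun t _ => h.integrable_payoff t fun a b => vStar u - u a b
  -- With a single action the right side is 0, so the additive constant cannot be absorbed; here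
  -- every summand of the regret is already nonpositive.
  rcases (Finset.univ.erase i).eq_empty_or_nonempty with hemp | ⟨j, hj⟩
  · rw [hemp, Finset.sum_empty, mul_zero]
    have hall : ∀ a, a = i := fun a => by
      by_contra ha
      have : a ∈ Finset.univ.erase i := by simp [ha]
      simp [hemp] at this
    refine integral_nonpos fun ω => Finset.sum_nonpos fun t _ => ?_
    have := hself (x t ω) (y t ω)
    rw [hall (x t ω), hgi] at this
    rw [hall (x t ω)]
    linarith
  have hg0 : ∀ a, 0 ≤ g a := fun a => by
    rcases eq_or_ne a i with rfl | ha
    · exact hgi.ge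
    · exact (hg a ha).le
  have hIr : ∀ t, Integrable (fun ω => u i (y t ω) - u (x t ω) (y t ω)) P := fun t =>
    h.integrable_payoff t fun a b => u i b - u a b
  have hIg : ∀ t, Integrable (fun ω => g (x t ω)) P := fun t =>
    h.integrable_payoff t fun a _ => g a
  have hIR : Integrable (fun ω => (1 + κ) * ∑ t ∈ Finset.range T,
      (u i (y t ω) - u (x t ω) (y t ω))) P :=
    (integrable_finsetSum _ fun t _ => hIr t).const_mul _
  have hIG : Integrable (fun ω => κ * ∑ t ∈ Finset.range T, g (x t ω)) P :=
    (integrable_finsetSum _ fun t _ => hIg t).const_mul _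
  have h1 : psmr P u x y T ≤ ∫ ω, ((1 + κ) * ∑ t ∈ Finset.range T,
      (u i (y t ω) - u (x t ω) (y t ω)) - κ * ∑ t ∈ Finset.range T, g (x t ω)) ∂P := by
    refine integral_mono hvI (hIR.sub hIG) fun ω => ?_
    simp only [Finset.mul_sum, ← Finset.sum_sub_distrib]
    exact Finset.sum_le_sum fun t _ => hself _ _
  rw [integral_sub hIR hIG, integral_const_mul, integral_const_mul,
    integral_finsetSum _ fun t _ => hIg t] at h1
  have hpg : ∀ t a ω, |p t ω a * g a| ≤ 2 := fun t a ω => by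
    have hle : p t ω a ≤ 1 := by
      rw [← (hmem t ω).2]
      exact Finset.single_le_sum (fun b _ => (hmem t ω).1 b) (Finset.mem_univ a)
    rw [abs_of_nonneg (mul_nonneg ((hmem t ω).1 a) (hg0 a))]
    nlinarith [hg0 a, hg2 a, (hmem t ω).1 a]
  have hIp : ∀ t, Integrable (fun ω => ∑ a ∈ Finset.univ.erase i, p t ω a * g a) P := fun t =>
    integrable_finsetSum _ fun a _ => h.integrable_comp_strategy t (F := fun q => q a * g a)
      (by fun_prop) (hpg t a)
  have h2 : ∀ t, ∫ ω, g (x t ω) ∂P = ∫ ω, ∑ a ∈ Finset.univ.erase i, p t ω a * g a ∂P := by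
    intro t
    rw [(h.integral_sample t (F := fun a _ => g a) (fun _ => measurable_const) (hpg t)).2]
    refine integral_congr_ae (Filter.Eventually.of_forall fun ω => ?_)
    simp only
    rw [← Finset.add_sum_erase _ _ (Finset.mem_univ i), hgi, mul_zero, zero_add]
  have hround : ∀ t : ℕ, (1 + κ) * (12 / √((t : ℝ) + 1)
        * ∫ ω, ∑ a ∈ Finset.univ.erase i, √(p t ω a) ∂P) - κ * ∫ ω, g (x t ω) ∂P
      ≤ ∑ a ∈ Finset.univ.erase i, 144 / κ * (1 / g a) * (1 / ((t : ℝ) + 1)) := by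
    intro t
    have hIs := h.integrable_sqrt_strategy hmem i t
    rw [h2 t, ← mul_assoc, ← integral_const_mul, ← integral_const_mul,
      ← integral_sub (hIs.const_mul _) ((hIp t).const_mul _)]
    refine (integral_mono ((hIs.const_mul _).sub ((hIp t).const_mul _))
      (integrable_const (∑ a ∈ Finset.univ.erase i, 144 / κ * (1 / g a) * (1 / ((t : ℝ) + 1))))
      fun ω => ?_).trans (by simp)
    simp only [Finset.mul_sum, Pi.sub_apply, ← Finset.sum_sub_distrib]
    refine Finset.sum_le_sum fun a ha => ?_
    have hga := hg a (Finset.ne_of_mem_erase ha)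
    have e1 := Real.sq_sqrt ((hmem t ω).1 a)
    have e2 := Real.sq_sqrt (show (0 : ℝ) ≤ (t : ℝ) + 1 by positivity)
    have p1 := Real.sqrt_nonneg (p t ω a)
    have p2 : 0 < √((t : ℝ) + 1) := Real.sqrt_pos.2 (by positivity)
    rw [← e1, Real.sqrt_sq p1]
    nth_rewrite 2 [← e2]
    generalize √(p t ω a) = c at *
    generalize √((t : ℝ) + 1) = d at *
    have h3 : (1 + κ) * (12 / d) * c ≤ 24 / d * c := by
      have : (1 + κ) * (12 / d) ≤ 24 / d := by
        rw [← mul_div_assoc]; gcongr; linarith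
      gcongr
    -- With c = √(p_a) and d = √(t + 1), a complete square bounds the linear term in c minus the
    -- quadratic one by 144/(κ g d²).
    have h4 : 144 / κ * (1 / g a) * (1 / d ^ 2) - (24 / d * c - κ * (c ^ 2 * g a))
        = (12 - κ * g a * c * d) ^ 2 / (κ * g a * d ^ 2) := by
      field_simp
      ring
    have h5 : 0 ≤ (12 - κ * g a * c * d) ^ 2 / (κ * g a * d ^ 2) := by positivity
    linarith
  have hsum := Finset.sum_le_sum (s := Finset.range T) fun t _ => hround t
  rw [Finset.sum_comm, Finset.sum_sub_distrib, ← Finset.mul_sum, ← Finset.mul_sum] at hsum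
  simp only [← Finset.mul_sum] at hsum
  have hbound : ∑ a ∈ Finset.univ.erase i,
      144 / κ * (1 / g a) * ∑ t ∈ Finset.range T, 1 / ((t : ℝ) + 1)
      ≤ 432 / κ * ∑ a ∈ Finset.univ.erase i, Real.log T / g a := by
    rw [Finset.mul_sum]
    refine Finset.sum_le_sum fun a ha => ?_
    have hga := hg a (Finset.ne_of_mem_erase ha)
    refine (mul_le_mul_of_nonneg_left (sum_one_div_le_log hT) (by positivity)).trans
      (le_of_eq ?_)
    ring
  -- A single term suffices: log T ≥ 2/3 and g ≤ 2. This absorbs the additive (1 + κ) · 6 ≤ 12.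
  have hone : 1 / 3 ≤ ∑ a ∈ Finset.univ.erase i, Real.log T / g a := by
    refine le_trans ?_ (Finset.single_le_sum (f := fun a => Real.log T / g a)
      (fun a _ => div_nonneg (by linarith) (hg0 a)) hj)
    have hgj := hg j (Finset.ne_of_mem_erase hj)
    rw [le_div_iff₀ hgj]
    linarith [hg2 j]
  have hreg := mul_le_mul_of_nonneg_left (h.regret_le halg i T) (by linarith : 0 ≤ 1 + κ)
  have htwelve : 12 ≤ 36 / κ * ∑ a ∈ Finset.univ.erase i, Real.log T / g a := by
    have : 36 ≤ 36 / κ := by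
      rw [le_div_iff₀ hκ]; linarith
    nlinarith
  have hfinal : 468 / κ * ∑ a ∈ Finset.univ.erase i, Real.log T / g a
      = 432 / κ * ∑ a ∈ Finset.univ.erase i, Real.log T / g a
        + 36 / κ * ∑ a ∈ Finset.univ.erase i, Real.log T / g a := by ring
  rw [hfinal]
  linarith

theorem IsPlay.psmr_le_of_isStrictPSNE [Nontrivial Y] (h : IsPlay P u ℱ x y r p)
    (halg : ∀ ω, IsTsallisINF (1 / 2) (fun t => 1 / (2 * Real.sqrt t))
      (fun t => x t ω) (fun t => r t ω) (fun t => p t ω))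
    (hu : ∀ a b, u a b ∈ Set.Icc (-1 : ℝ) 1) {xs : X} {ys : Y} (hs : IsStrictPSNE u xs ys)
    {T : ℕ} (hT : 2 ≤ T) :
    psmr P u x y T ≤ 1872 * (1 / minColGap u xs ys *
      ∑ a ∈ Finset.univ.erase xs, Real.log T / rowGap u xs ys a) := by
  have hpos := hs.minColGap_pos
  obtain ⟨b₀, hb₀⟩ := exists_ne ys
  have hle2 : minColGap u xs ys ≤ 2 := (minColGap_le u xs hb₀).trans (by
    unfold colGap
    linarith [(hu xs b₀).2, (hu xs ys).1])
  have hv := hs.isPSNE.vStar_eq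
  -- The choice κ = Δ^C_min/4 balances the two cases. At y* the self-bounding inequality is an
  -- equality for every κ. Elsewhere the gain Δ^C_min covers the error of at most 4κ from evaluating
  -- the row gap at another column.
  refine (h.psmr_le_log halg (i := xs) (g := rowGap u xs ys) (κ := minColGap u xs ys / 4)
    (sub_self _) (fun a ha => sub_pos.2 (hs.1 a ha)) (rowGap_le_two hu xs ys) (by linarith)
    (by linarith) (fun a b => ?_) hT).trans (le_of_eq ?_)
  · rw [hv]
    rcases eq_or_ne b ys with rfl | hb
    · unfold rowGap
      linarith
    · have hc := minColGap_le u xs hb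
      unfold colGap at hc
      unfold rowGap
      have h1 : -4 ≤ u xs b - u a b - (u xs ys - u a ys) := by
        linarith [(hu xs b).1, (hu a b).2, (hu xs ys).2, (hu a ys).1]
      nlinarith
  · ring

theorem IsPlay.psmr_le_of_isStrictPSNE_of_subsingleton [Subsingleton Y]
    (h : IsPlay P u ℱ x y r p)
    (halg : ∀ ω, IsTsallisINF (1 / 2) (fun t => 1 / (2 * Real.sqrt t))
      (fun t => x t ω) (fun t => r t ω) (fun t => p t ω))
    (hu : ∀ a b, u a b ∈ Set.Icc (-1 : ℝ) 1) {xs : X} {ys : Y} (hs : IsStrictPSNE u xs ys)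
    {T : ℕ} (hT : 2 ≤ T) :
    psmr P u x y T ≤ 468 * ∑ a ∈ Finset.univ.erase xs, Real.log T / rowGap u xs ys a := by
  have hv := hs.isPSNE.vStar_eq
  have := h.psmr_le_log halg (i := xs) (g := rowGap u xs ys) (κ := 1)
    (sub_self _) (fun a ha => sub_pos.2 (hs.1 a ha)) (rowGap_le_two hu xs ys) one_pos le_rfl
    (fun a b => by
      rw [hv, Subsingleton.elim b ys]
      unfold rowGap
      linarith) hT
  simpa using this

end Play

end ZeroSumGame

theorem theorem1 :
    ∃ C : ℝ, 0 < C ∧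
      ∀ (X Y Ω : Type*) [Fintype X] [Fintype Y] [DecidableEq X] [Nonempty X] [Nonempty Y]
        [MeasurableSpace Ω]
        (P : Measure Ω) [IsProbabilityMeasure P]
        (u : X → Y → ℝ) (_hu : ∀ x y, u x y ∈ Set.Icc (-1 : ℝ) 1)
        (ℱ : Filtration ℕ ‹MeasurableSpace Ω›)
        (x : ℕ → Ω → X) (y : ℕ → Ω → Y) (r : ℕ → Ω → ℝ) (p : ℕ → Ω → X → ℝ)
        (_hplay : IsPlay P u ℱ x y r p)
        (_halg : ∀ ω, IsTsallisINF (1 / 2) (fun t => 1 / (2 * Real.sqrt t))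
          (fun t => x t ω) (fun t => r t ω) (fun t => p t ω)),
        -- the worst-case bound
        (∀ T : ℕ, psmr P u x y T ≤ C * Real.sqrt (Fintype.card X * T)) ∧
        -- the bound in the presence of a strict equilibrium
        (∀ xs ys, IsStrictPSNE u xs ys → 2 ≤ Fintype.card Y → ∀ T : ℕ, 2 ≤ T →
          psmr P u x y T ≤ C * (1 / minColGap u xs ys *
            ∑ a ∈ Finset.univ.erase xs, Real.log T / rowGap u xs ys a)) ∧
        -- the same when the adversary has a single action, where the factor is read as `1`
        (∀ xs ys, IsStrictPSNE u xs ys → Fintype.card Y = 1 → ∀ T : ℕ, 2 ≤ T →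
          psmr P u x y T ≤ C * ∑ a ∈ Finset.univ.erase xs, Real.log T / rowGap u xs ys a) ∧
        -- the bound in the absence of an equilibrium
        ((¬ ∃ xs ys, IsPSNE u xs ys) → 0 < mixGap u → ∀ T : ℕ,
          psmr P u x y T ≤ C * (Fintype.card X / mixGap u)) := by
  -- The strict-equilibrium bound dictates the constant: 1872 = 4 · 468, the 4 coming from κ.
  refine ⟨1872, by norm_num, ?_⟩
  intro X Y Ω _ _ _ _ _ _ P _ u hu ℱ x y r p hplay halg
  refine ⟨fun T => ?_, fun xs ys hs hY T hT => ?_, fun xs ys hs hY T hT => ?_,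
    fun _ hgap T => ?_⟩
  · refine (hplay.psmr_le_sqrt halg T).trans ?_
    gcongr
    norm_num
  · have : Nontrivial Y := Fintype.one_lt_card_iff_nontrivial.1 hY
    exact hplay.psmr_le_of_isStrictPSNE halg hu hs hT
  · have : Subsingleton Y := Fintype.card_le_one_iff_subsingleton.1 hY.le
    refine (hplay.psmr_le_of_isStrictPSNE_of_subsingleton halg hu hs hT).trans ?_
    have := sum_log_div_rowGap_nonneg hs T
    gcongr
    norm_num
  · refine (hplay.psmr_le_div_mixGap halg hgap T).trans ?_
    gcongr
    norm_num
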